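/- **Conventions.** A *partial matrix* is a symmetric $n\times n$ matrix $M=(m_{ij})$ with zero diagonal, each of whose off-diagonal entries is either a specified number in $\mathbb{R}_{\ge 0}$ or unspecified. A pair $(M,d)$ with $d\ge 1$ an integer is an *instance* of $d$-EDMC (Euclidean distance matrix completion); it is a *yes-instance* if there are points $p_1,\dots,p_n\in\mathbb{R}^d$, not necessarily distinct, with $\|p_i-p_j\|_2^2=m_{ij}$ for every specified entry $m_{ij}$, and a *no-instance* otherwise. Two instances are *equivalent* if both are yes-instances or both are no-instances. $M$ *excludes a $t$-block pattern* if there are no disjoint sets $I_1,I_2\subseteq\{1,\dots,n\}$ with $|I_1|=|I_2|=t$ such that $m_{ij}$ is unspecified for all $i\in I_1$, $j\in I_2$. Algorithms run on a real RAM: arithmetic operations and comparisons of real numbers take unit time, and running time is measured in terms of $n$. **Theorem (Compression for $K_{t,t}$-free complements).** There are an absolute constant $C$ and a polynomial-time algorithm that, given an instance $(M,d)$ of $d$-EDMC, either correctly decides whether $(M,d)$ is a yes-instance, or outputs an equivalent instance $(M',d)$ in which $M'$ is a (nonempty) principal submatrix of $M$ such that, for every $t\ge 1$ for which $M$ excludes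 a $t$-block pattern, $M'$ has at most $(d+1)^{Ct^2}$ rows and columns. -/

import Mathlib

/-- An `n × n` partial matrix: every entry is a real number or unspecified (`none`); it is symmetric,
its diagonal is specified and zero, and its specified entries are nonnegative. -/
structure PartialMatrix (n : ℕ) where
  entry : Fin n → Fin n → Option ℝ
  symm : ∀ i j, entry i j = entry j i
  diag : ∀ i, entry i i = some 0
  nonneg : ∀ i j x, entry i j = some x → 0 ≤ x

namespace PartialMatrix

/-- The principal submatrix on the rows and columns listed, in increasing order, by `f`. -/
def principal {m n : ℕ} (M : PartialMatrix n) (f : Fin m ↪o Fin n) : PartialMatrix m where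
  entry i j := M.entry (f i) (f j)
  symm i j := M.symm (f i) (f j)
  diag i := M.diag (f i)
  nonneg i j := M.nonneg (f i) (f j)

/-- `M` excludes a `t`-block pattern: there are no disjoint sets of `t` rows and `t` columns
all of whose common entries are unspecified. -/
def ExcludesBlock {n : ℕ} (M : PartialMatrix n) (t : ℕ) : Prop :=
  ¬ ∃ I J : Finset (Fin n), Disjoint I J ∧ I.card = t ∧ J.card = t ∧
    ∀ i ∈ I, ∀ j ∈ J, M.entry i j = none

end PartialMatrix

/-- `D` is the matrix of squared distances of `n` (not necessarily distinct) points of `ℝ^d`. -/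
def IsEDM {n : ℕ} (d : ℕ) (D : Matrix (Fin n) (Fin n) ℝ) : Prop :=
  ∃ p : Fin n → EuclideanSpace ℝ (Fin d), ∀ i j, D i j = ‖p i - p j‖ ^ 2

/-- `(M, d)` is a yes-instance: some Euclidean distance matrix in `ℝ^d` agrees with all the
specified entries of `M`. -/
def PartialMatrix.Completable {n : ℕ} (M : PartialMatrix n) (d : ℕ) : Prop :=
  ∃ D : Matrix (Fin n) (Fin n) ℝ, IsEDM d D ∧ ∀ i j x, M.entry i j = some x → D i j = x

/-! ### A real RAM

The memory consists of arrays of natural numbers and arrays of real numbers, whose cells are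
addressed by two computed natural numbers. A program mentions finitely many arrays by name.
Natural numbers can be added, subtracted (truncated at `0`) and compared; real numbers can be added,
subtracted, multiplied, divided and compared. A natural number can be converted to a real number,
but there is no way back (no rounding), and the only constants are natural numbers. Every operation
and every memory access costs one unit of time. -/
namespace RealRAM

/-- `nat a i j` and `real a i j` are the contents of cell `(i, j)` of the `a`-th array. -/
@[ext]
structure State where
  nat : ℕ → ℕ → ℕ → ℕ
  real : ℕ → ℕ → ℕ → ℝ

/-- Expressions with a natural number as value. -/
inductive NatExpr where
  | const (c : ℕ)
  | cell (a : ℕ) (i j : NatExpr)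
  | add (e f : NatExpr)
  | sub (e f : NatExpr)

namespace NatExpr

def eval (s : State) : NatExpr → ℕ
  | const c => c
  | cell a i j => s.nat a (i.eval s) (j.eval s)
  | add e f => e.eval s + f.eval s
  | sub e f => e.eval s - f.eval s

def cost : NatExpr → ℕ
  | const _ => 1
  | cell _ i j => i.cost + j.cost + 1
  | add e f => e.cost + f.cost + 1
  | sub e f => e.cost + f.cost + 1

end NatExpr

/-- Expressions with a real number as value; a quotient by zero has the value zero. -/
inductive RealExpr where
  | ofNat (e : NatExpr)
  | cell (a : ℕ) (i j : NatExpr)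
  | add (e f : RealExpr)
  | sub (e f : RealExpr)
  | mul (e f : RealExpr)
  | div (e f : RealExpr)

namespace RealExpr

noncomputable def eval (s : State) : RealExpr → ℝ
  | ofNat e => (e.eval s : ℝ)
  | cell a i j => s.real a (i.eval s) (j.eval s)
  | add e f => e.eval s + f.eval s
  | sub e f => e.eval s - f.eval s
  | mul e f => e.eval s * f.eval s
  | div e f => e.eval s / f.eval s

def cost : RealExpr → ℕ
  | ofNat e => e.cost + 1
  | cell _ i j => i.cost + j.cost + 1
  | add e f => e.cost + f.cost + 1
  | sub e f => e.cost + f.cost + 1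
  | mul e f => e.cost + f.cost + 1
  | div e f => e.cost + f.cost + 1

end RealExpr

/-- Tests. -/
inductive Cond where
  | natLE (e f : NatExpr)
  | realLE (e f : RealExpr)
  | neg (c : Cond)
  | conj (b c : Cond)

namespace Cond

def Holds (s : State) : Cond → Prop
  | natLE e f => e.eval s ≤ f.eval s
  | realLE e f => e.eval s ≤ f.eval s
  | neg c => ¬ c.Holds s
  | conj b c => b.Holds s ∧ c.Holds s

def cost : Cond → ℕ
  | natLE e f => e.cost + f.cost + 1
  | realLE e f => e.cost + f.cost + 1
  | neg c => c.cost + 1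
  | conj b c => b.cost + c.cost + 1

end Cond

/-- Programs; `loop c p` repeats `p` as long as `c` holds. -/
inductive Prog where
  | skip
  | setNat (a : ℕ) (i j : NatExpr) (e : NatExpr)
  | setReal (a : ℕ) (i j : NatExpr) (e : RealExpr)
  | seq (p q : Prog)
  | ite (c : Cond) (p q : Prog)
  | loop (c : Cond) (p : Prog)

namespace State

/-- Write `x` into cell `(i, j)` of the `a`-th array of natural numbers. -/
def setNat (s : State) (a i j x : ℕ) : State where
  nat a' i' j' := if a' = a ∧ i' = i ∧ j' = j then x else s.nat a' i' j'
  real := s.real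

/-- Write `x` into cell `(i, j)` of the `a`-th array of real numbers. -/
noncomputable def setReal (s : State) (a i j : ℕ) (x : ℝ) : State where
  nat := s.nat
  real a' i' j' := if a' = a ∧ i' = i ∧ j' = j then x else s.real a' i' j'

end State

/-- `Exec p s s' k`: started in state `s`, the program `p` halts in state `s'` after `k` steps. -/
inductive Exec : Prog → State → State → ℕ → Prop
  | skip (s : State) : Exec .skip s s 1
  | setNat (s : State) (a : ℕ) (i j e : NatExpr) :
      Exec (.setNat a i j e) s (s.setNat a (i.eval s) (j.eval s) (e.eval s))
        (i.cost + j.cost + e.cost + 1)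
  | setReal (s : State) (a : ℕ) (i j : NatExpr) (e : RealExpr) :
      Exec (.setReal a i j e) s (s.setReal a (i.eval s) (j.eval s) (e.eval s))
        (i.cost + j.cost + e.cost + 1)
  | seq {p q : Prog} {s s' s'' : State} {k l : ℕ} :
      Exec p s s' k → Exec q s' s'' l → Exec (.seq p q) s s'' (k + l)
  | ite_true {c : Cond} {p q : Prog} {s s' : State} {k : ℕ} :
      c.Holds s → Exec p s s' k → Exec (.ite c p q) s s' (c.cost + 1 + k)
  | ite_false {c : Cond} {p q : Prog} {s s' : State} {k : ℕ} :
      ¬ c.Holds s → Exec q s s' k → Exec (.ite c p q) s s' (c.cost + 1 + k)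
  | loop_true {c : Cond} {p : Prog} {s s' s'' : State} {k l : ℕ} :
      c.Holds s → Exec p s s' k → Exec (.loop c p) s' s'' l →
        Exec (.loop c p) s s'' (c.cost + 1 + k + l)
  | loop_false {c : Cond} {p : Prog} {s : State} :
      ¬ c.Holds s → Exec (.loop c p) s s (c.cost + 1)

/-- How an instance `(M, d)` is stored: the size `n` and the dimension `d` are in cell `(0, 0)` of
the arrays `0` and `1` of natural numbers, array `2` of natural numbers tells which entries are
specified, and array `0` of real numbers holds the specified entries. -/
def Encodes (s : State) {n : ℕ} (M : PartialMatrix n) (d : ℕ) : Prop :=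
  s.nat 0 0 0 = n ∧ s.nat 1 0 0 = d ∧
    ∀ i j : Fin n, s.nat 2 i j = (if (M.entry i j).isSome then 1 else 0) ∧
      ∀ x, M.entry i j = some x → s.real 0 i j = x

/-- The initial state on input `(M, d)`: the instance is stored as in `Encodes`, and all other
cells contain `0`. -/
noncomputable def input {n : ℕ} (M : PartialMatrix n) (d : ℕ) : State where
  nat a i j :=
    if a = 0 ∧ i = 0 ∧ j = 0 then n
    else if a = 1 ∧ i = 0 ∧ j = 0 then d
    else if h : a = 2 ∧ i < n ∧ j < n then
      (if (M.entry ⟨i, h.2.1⟩ ⟨j, h.2.2⟩).isSome then 1 else 0)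
    else 0
  real a i j :=
    if h : a = 0 ∧ i < n ∧ j < n then (M.entry ⟨i, h.2.1⟩ ⟨j, h.2.2⟩).getD 0 else 0

/-- The cell with the kind of the answer: `0` is "no", `1` is "yes", and `2` announces an
instance that is stored as in `Encodes`. -/
def State.verdict (s : State) : ℕ := s.nat 3 0 0

end RealRAM

/-!
Fix a greedy clique `K` among the remaining rows `A`. If a `t`-block pattern is excluded, then a
large `A` has a row adjacent to all but a small fraction of `A`, so that `#K` is at least about
`#A ^ (1 / t)`. The entries `m_{ij}` with `i ∈ C`, together with a border of ones, make up the
Cayley–Menger columns of the rows `C`.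

Over a realizable clique these columns have rank at most `d + 2`, and if the column of `v ∈ K`
depends on those of `S ⊆ K`, then the point of `v` is an affine combination of those of `S`. Where
`u` is adjacent to `v` and to `S`, it follows that the same dependence holds over `insert u K`.
So if the rank is too large, or such a dependence does not extend to `insert u K`, the instance is a
no-instance. If, on the other hand, for some `v ∈ K` the column of `v` over `insert u K` depends on
those of the neighbours of `u` in `K.erase v`, for all `u` adjacent to `v`, then `v` can be put back
into every realization of `A.erase v`, and may be deleted. In the remaining case every `v ∈ K` has
some `u` adjacent to it for which the dependence over `K` fails. As the rank is at most `d + 2`, the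
excluded block pattern then bounds `#K`, by the Kővári–Sós–Turán theorem, and hence `#A`.

All ranks are computed by the Gram–Schmidt process, which needs only field operations.
-/

/-! ### Bicliques and ranks -/

open Finset in
theorem sum_choose_card_le_of_no_biclique {V : Type*} {R : V → V → Prop} [DecidableRel R]
    {U Y : Finset V} {t : ℕ}
    (hR : ∀ I ⊆ U, ∀ J ⊆ Y, #I = t → #J = t → ∃ i ∈ I, ∃ j ∈ J, ¬ R i j) :
    ∑ u ∈ U, (#{y ∈ Y | R u y}).choose t ≤ t * (#Y).choose t := by
  classical
  have above (u : V) : (Y.powersetCard t).bipartiteAbove (fun u J => ∀ j ∈ J, R u j) u =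
      powersetCard t {y ∈ Y | R u y} := by
    ext J
    simp only [mem_bipartiteAbove, mem_powersetCard, subset_iff, mem_filter]
    grind
  have below (J) (hJ : J ∈ Y.powersetCard t) :
      #(U.bipartiteBelow (fun u J => ∀ j ∈ J, R u j) J) ≤ t := by
    by_contra! hlt
    obtain ⟨I, hI, hIt⟩ := exists_subset_card_eq hlt.le
    rw [mem_powersetCard] at hJ
    obtain ⟨i, hi, j, hj, hij⟩ := hR I (hI.trans (filter_subset _ _)) J hJ.1 hIt hJ.2
    exact hij ((mem_filter.1 (hI hi)).2 j hj)
  calc ∑ u ∈ U, (#{y ∈ Y | R u y}).choose t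
      = ∑ u ∈ U, #((Y.powersetCard t).bipartiteAbove (fun u J => ∀ j ∈ J, R u j) u) := by
        simp only [above, card_powersetCard]
    _ = ∑ J ∈ Y.powersetCard t, #(U.bipartiteBelow (fun u J => ∀ j ∈ J, R u j) J) :=
        sum_card_bipartiteAbove_eq_sum_card_bipartiteBelow _
    _ ≤ #(Y.powersetCard t) • t := sum_le_card_nsmul _ _ _ below
    _ = t * (#Y).choose t := by rw [card_powersetCard, smul_eq_mul, mul_comm]

open Finset in
/-- The **Kővári–Sós–Turán** bound. -/
theorem card_le_of_no_biclique {V : Type*} {R : V → V → Prop} [DecidableRel R] {U Y : Finset V}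
    {t c : ℕ} (hY : Y.Nonempty)
    (hR : ∀ I ⊆ U, ∀ J ⊆ Y, #I = t → #J = t → ∃ i ∈ I, ∃ j ∈ J, ¬ R i j)
    (hdeg : ∀ u ∈ U, #Y ≤ c * (#{y ∈ Y | R u y} + 1 - t)) : #U ≤ t * c ^ t := by
  have term (u) (hu : u ∈ U) :
      #Y ^ t ≤ c ^ t * (t.factorial * (#{y ∈ Y | R u y}).choose t) := by
    rw [← Nat.descFactorial_eq_factorial_mul_choose]
    calc #Y ^ t ≤ (c * (#{y ∈ Y | R u y} + 1 - t)) ^ t := Nat.pow_le_pow_left (hdeg u hu) _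
      _ = c ^ t * (#{y ∈ Y | R u y} + 1 - t) ^ t := mul_pow _ _ _
      _ ≤ _ := Nat.mul_le_mul_left _ (Nat.pow_sub_le_descFactorial _ _)
  refine Nat.le_of_mul_le_mul_right (c := #Y ^ t) ?_ (pow_pos hY.card_pos t)
  calc #U * #Y ^ t = ∑ _ ∈ U, #Y ^ t := by simp
    _ ≤ ∑ u ∈ U, c ^ t * (t.factorial * (#{y ∈ Y | R u y}).choose t) := sum_le_sum term
    _ = c ^ t * t.factorial * ∑ u ∈ U, (#{y ∈ Y | R u y}).choose t := by
        simp only [mul_sum, mul_assoc]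
    _ ≤ c ^ t * t.factorial * (t * (#Y).choose t) :=
        Nat.mul_le_mul_left _ (sum_choose_card_le_of_no_biclique hR)
    _ = t * c ^ t * (#Y).descFactorial t := by
        rw [Nat.descFactorial_eq_factorial_mul_choose]
        ring
    _ ≤ t * c ^ t * #Y ^ t := Nat.mul_le_mul_left _ (Nat.descFactorial_le_pow _ _)

/-- `adj` has no `t`-block pattern: any `t` vertices `I` and any `t` vertices `J`, disjoint from `I`
or not, are joined by an edge. For a reflexive relation it suffices that this holds for disjoint
sets. -/
def NoBlock {V : Type*} (adj : V → V → Prop) (t : ℕ) : Prop :=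
  ∀ I J : Finset V, I.card = t → J.card = t → ∃ i ∈ I, ∃ j ∈ J, adj i j

namespace NoBlock

open Finset Module Submodule

variable {V : Type*} {adj : V → V → Prop} [DecidableRel adj] {t : ℕ}

theorem card_le {U Y : Finset V} {c : ℕ} (h : NoBlock adj t) (hY : 2 * c * t ≤ #Y)
    (hY' : Y.Nonempty) (hdeg : ∀ u ∈ U, #Y ≤ c * (#{y ∈ Y | ¬ adj u y} + 1)) :
    #U ≤ t * (2 * c) ^ t := by
  refine card_le_of_no_biclique (R := fun u y => ¬ adj u y) hY' (fun I _ J _ hI hJ => ?_)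
    fun u hu => ?_
  · obtain ⟨i, hi, j, hj, hij⟩ := h I J hI hJ
    exact ⟨i, hi, j, hj, not_not.2 hij⟩
  · have := hdeg u hu
    rw [Nat.mul_sub]
    have : 2 * c * (#{y ∈ Y | ¬ adj u y} + 1) = 2 * (c * (#{y ∈ Y | ¬ adj u y} + 1)) := by ring
    omega

theorem exists_few_nonadj (h : NoBlock adj t) (ht : t ≠ 0) {X : Finset V} {L : ℕ}
    (hX : t * (8 * L) ^ t < #X) : ∃ b ∈ X, 4 * L * #{y ∈ X | ¬ adj b y} ≤ #X := by
  by_contra! hcon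
  refine hX.not_ge ?_
  have h8 : 8 * L ≤ (8 * L) ^ t := Nat.le_self_pow ht _
  simpa only [show 2 * (4 * L) = 8 * L by ring] using
    h.card_le (c := 4 * L) (by nlinarith) (card_pos.1 (by omega)) fun u hu => by
      have := hcon u hu
      lia

end NoBlock

open Finset in
theorem exists_subset_forall_card_le_of_lt {V : Type*} [DecidableEq V] (rk : Finset V → ℕ) {D : ℕ}
    (hD : D ≠ 0) {K : Finset V} (hrk : rk K ≤ D) :
    ∃ K' ⊆ K, 2 * #(K \ K') ≤ #K ∧ ∀ K'' ⊆ K', rk K'' < rk K' → #K ≤ 2 * D * #(K' \ K'') := by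
  obtain ⟨K', hK', hmin⟩ := exists_min_image K.powerset
    (fun K' => 2 * D * #(K \ K') + #K * rk K') ⟨K, by simp⟩
  rw [mem_powerset] at hK'
  refine ⟨K', hK', ?_, fun K'' hK'' hlt => ?_⟩
  · have h := hmin K (by simp)
    simp only [sdiff_self, bot_eq_empty, card_empty, mul_zero, zero_add] at h
    refine Nat.le_of_mul_le_mul_left (c := D) ?_ (Nat.pos_of_ne_zero hD)
    nlinarith [Nat.mul_le_mul_left #K hrk]
  · have h := hmin K'' (mem_powerset.2 (hK''.trans hK'))
    have hcard : #(K \ K'') = #(K \ K') + #(K' \ K'') := by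
      have h₁ := card_sdiff_add_card_eq_card (hK''.trans hK')
      have h₂ := card_sdiff_add_card_eq_card hK'
      have h₃ := card_sdiff_add_card_eq_card hK''
      omega
    simp only [hcard] at h
    nlinarith [Nat.mul_le_mul_left #K (Nat.succ_le_of_lt hlt)]

section Span

open Finset Module Submodule

variable {V 𝕜 W : Type*} [Field 𝕜] [AddCommGroup W] [Module 𝕜 W]

theorem card_le_finrank_span_of_notMem_span {w : V → W} {A : Finset V}
    (h : ∀ v ∈ A, w v ∉ span 𝕜 (w '' (A \ {v}))) : #A ≤ finrank 𝕜 (span 𝕜 (w '' A)) := by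
  have hli : LinearIndepOn 𝕜 w (A : Set V) := linearIndepOn_iff_notMem_span.2 h
  rw [Set.image_eq_range]
  exact (finrank_span_eq_card hli.linearIndependent).trans (Fintype.card_coe A) |>.ge

variable [Module.Finite 𝕜 W]

theorem finrank_span_insert_le_iff {x : W} {s : Set W} :
    finrank 𝕜 (span 𝕜 (insert x s)) ≤ finrank 𝕜 (span 𝕜 s) ↔ x ∈ span 𝕜 s := by
  refine ⟨fun h => ?_, fun h => by rw [span_insert_eq_span h]⟩
  rw [eq_of_le_of_finrank_le (span_mono (Set.subset_insert x s)) h]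
  exact subset_span (Set.mem_insert x s)

theorem card_le_mul_card_image_of_notMem_span [DecidableEq V] {w : V → W} {A : Finset V}
    {u : V → V} {D : ℕ} (hrank : finrank 𝕜 (span 𝕜 (w '' A)) ≤ D)
    (h : ∀ v ∈ A, w v ∉ span 𝕜 (w '' {s | s ∈ A ∧ u s = u v ∧ s ≠ v})) :
    #A ≤ D * #(A.image u) := by
  refine card_le_mul_card_image _ _ fun a _ => ?_
  refine (card_le_finrank_span_of_notMem_span (𝕜 := 𝕜) (w := w) fun v hv hmem => ?_).trans
    ((finrank_mono (span_mono (Set.image_mono (coe_subset.2 (filter_subset _ _))))).trans hrank)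
  obtain ⟨hvA, rfl⟩ := mem_filter.1 hv
  refine h v hvA (span_mono (Set.image_mono ?_) hmem)
  rintro s ⟨hs, hsv⟩
  exact ⟨(mem_filter.1 hs).1, (mem_filter.1 hs).2, hsv⟩

theorem finrank_span_sep_lt {w : V → W} {w₀ : W} {A : Set V} {v : V} {F : Submodule 𝕜 W}
    (hv : v ∈ A) (hw₀ : w₀ ∈ F) (hvF : w v ∉ F) :
    finrank 𝕜 (span 𝕜 (insert w₀ (w '' {s ∈ A | w s ∈ F}))) <
      finrank 𝕜 (span 𝕜 (insert w₀ (w '' A))) := by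
  refine finrank_lt_finrank_of_lt (lt_of_le_of_ne (span_mono ?_) fun heq => hvF ?_)
  · exact Set.insert_subset_insert (Set.image_mono fun s hs => hs.1)
  · have hvA : w v ∈ span 𝕜 (insert w₀ (w '' A)) :=
      subset_span (Set.mem_insert_of_mem _ ⟨v, hv, rfl⟩)
    rw [← heq] at hvA
    refine span_le.2 ?_ hvA
    rintro _ (rfl | ⟨s, hs, rfl⟩)
    exacts [hw₀, hs.2]

namespace NoBlock

variable {adj : V → V → Prop} {t D : ℕ} {K : Finset V} {w : V → W} {w₀ : W}

theorem card_le_of_notMem_span_of_le (h : NoBlock adj t) (hD : D ≠ 0) (hK : 4 * D * t ≤ #K)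
    (hrank : finrank 𝕜 (span 𝕜 (insert w₀ (w '' K))) ≤ D) {u : V → V}
    (hu : ∀ v ∈ K, adj (u v) v)
    (hspan : ∀ v ∈ K, w v ∉ span 𝕜 (insert w₀ (w '' {s | s ∈ K ∧ adj (u v) s ∧ s ≠ v}))) :
    #K ≤ 2 * D * (t * (4 * D) ^ t) := by
  classical
  rcases K.eq_empty_or_nonempty with rfl | hne
  · exact Nat.zero_le _
  obtain ⟨K', hK', hhalf, hlose⟩ := exists_subset_forall_card_le_of_lt
    (fun K' : Finset V => finrank 𝕜 (span 𝕜 (insert w₀ (w '' K')))) hD hrank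
  -- Keeping only the span of the neighbours of `u v` loses rank, hence many elements of `K'`, and
  -- all of these but `v` are non-neighbours of `u v`.
  have hdeg : ∀ v ∈ K', #K ≤ 2 * D * (#{y ∈ K | ¬ adj (u v) y} + 1) := fun v hv => by
    set F := span 𝕜 (insert w₀ (w '' {s | s ∈ K ∧ adj (u v) s ∧ s ≠ v}))
    have hlt := finrank_span_sep_lt (mem_coe.2 hv) (subset_span (Set.mem_insert w₀ _))
      (hspan v (hK' hv))
    refine (hlose {s ∈ K' | w s ∈ F} (filter_subset _ _) (by rwa [coe_filter])).trans ?_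
    refine Nat.mul_le_mul_left _ (le_trans (card_le_card fun y hy => ?_) (card_insert_le v _))
    simp only [mem_sdiff, mem_filter, not_and, mem_insert] at hy ⊢
    by_contra! hcon
    exact hy.2 hy.1 (subset_span
      (Set.mem_insert_of_mem _ ⟨y, ⟨hK' hy.1, hcon.2 (hK' hy.1), hcon.1⟩, rfl⟩))
  have himage : #(K'.image u) ≤ t * (4 * D) ^ t := by
    have := h.card_le (U := K'.image u) (c := 2 * D) (by linarith) hne
      (forall_mem_image.2 fun v hv => hdeg v hv)
    rwa [show 2 * (2 * D) = 4 * D by ring] at this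
  have hfibre : #K' ≤ D * #(K'.image u) := by
    refine card_le_mul_card_image_of_notMem_span (𝕜 := 𝕜) (w := w)
      ((finrank_mono (span_mono ?_)).trans hrank) fun v hv hmem => ?_
    · exact (Set.image_mono (coe_subset.2 hK')).trans (Set.subset_insert _ _)
    · refine hspan v (hK' hv) (span_mono ((Set.image_mono ?_).trans (Set.subset_insert _ _)) hmem)
      exact fun s hs => ⟨hK' hs.1, hs.2.1 ▸ hu s (hK' hs.1), hs.2.2⟩
  have hsplit : #(K \ K') + #K' = #K := card_sdiff_add_card_eq_card hK'
  calc #K ≤ 2 * #K' := by omega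
    _ ≤ 2 * (D * (t * (4 * D) ^ t)) :=
      Nat.mul_le_mul_left _ (hfibre.trans (Nat.mul_le_mul_left _ himage))
    _ = 2 * D * (t * (4 * D) ^ t) := (mul_assoc _ _ _).symm

theorem card_le_of_notMem_span (h : NoBlock adj t) (ht : t ≠ 0) (hD : D ≠ 0)
    (hrank : finrank 𝕜 (span 𝕜 (insert w₀ (w '' K))) ≤ D)
    (hw : ∀ v ∈ K, ∃ u, adj u v ∧
      w v ∉ span 𝕜 (insert w₀ (w '' {s | s ∈ K ∧ adj u s ∧ s ≠ v}))) :
    #K ≤ 2 * D * (t * (4 * D) ^ t) := by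
  rcases le_total (4 * D * t) #K with hbig | hsmall
  · choose! u hu hspan using hw
    exact h.card_le_of_notMem_span_of_le hD hbig hrank hu hspan
  · calc #K ≤ 4 * D * t := hsmall
      _ ≤ (4 * D) ^ t * t := by gcongr; exact Nat.le_self_pow ht _
      _ ≤ 2 * D * (t * (4 * D) ^ t) := by
        rw [mul_comm]
        exact Nat.le_mul_of_pos_left _ (by omega)

end NoBlock

end Span

theorem compression_bound {m d t : ℕ} (hd : d ≠ 0) (ht : t ≠ 0)
    (h : m ≤ 2 * t * (8 * (2 * (d + 2) * (t * (4 * (d + 2)) ^ t) + 1)) ^ t) :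
    m ≤ (d + 1) ^ (20 * t ^ 2) := by
  have hd' : 1 ≤ d := Nat.one_le_iff_ne_zero.2 hd
  have ht' : 1 ≤ t := Nat.one_le_iff_ne_zero.2 ht
  set q := d + 1 with hq
  have two_pow_le (k : ℕ) : 2 ^ k ≤ q ^ k := Nat.pow_le_pow_left (by omega) k
  have hdq : d + 2 ≤ q ^ 2 := by nlinarith
  have htq : t ≤ q ^ t := Nat.lt_two_pow_self.le.trans (two_pow_le t)
  have h4 : 4 * (d + 2) ≤ q ^ 4 :=
    (Nat.mul_le_mul (two_pow_le 2) hdq).trans_eq (by ring)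
  have hK : 2 * (d + 2) * (t * (4 * (d + 2)) ^ t) + 1 ≤ q ^ (4 + 5 * t) :=
    calc 2 * (d + 2) * (t * (4 * (d + 2)) ^ t) + 1
      _ ≤ 2 * (2 * (d + 2) * (t * (4 * (d + 2)) ^ t)) := by
          have : 0 < 2 * (d + 2) * (t * (4 * (d + 2)) ^ t) := by positivity
          omega
      _ ≤ 2 * (2 * q ^ 2 * (q ^ t * (q ^ 4) ^ t)) := by gcongr
      _ = 2 ^ 2 * (q ^ 2 * (q ^ t * (q ^ 4) ^ t)) := by ring
      _ ≤ q ^ 2 * (q ^ 2 * (q ^ t * (q ^ 4) ^ t)) := Nat.mul_le_mul_right _ (two_pow_le 2)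
      _ = q ^ (4 + 5 * t) := by
          rw [← pow_mul, ← pow_add, ← pow_add, ← pow_add]
          congr 1
          ring
  calc m ≤ _ := h
    _ ≤ q * q ^ t * (q ^ 3 * q ^ (4 + 5 * t)) ^ t := by
        gcongr
        · omega
        · exact two_pow_le 3
    _ = q ^ (1 + 8 * t + 5 * t ^ 2) := by
        rw [← pow_succ', ← pow_add, ← pow_mul, ← pow_add]
        congr 1
        ring
    _ ≤ q ^ (20 * t ^ 2) := Nat.pow_le_pow_right (by omega) (by nlinarith)

/-! ### Realizability and bordered columns -/

section Geometry

open Finset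

variable {ι E : Type*} [NormedAddCommGroup E] [InnerProductSpace ℝ E] {p : ι → E}

/-- **Leibniz' relation** for affine combinations. -/
theorem sum_mul_norm_sub_sq {S : Finset ι} {f : ι → ℝ} (hf : ∑ i ∈ S, f i = 1) (x : E) :
    ∑ i ∈ S, f i * ‖x - p i‖ ^ 2 = ‖x - ∑ i ∈ S, f i • p i‖ ^ 2 +
      ∑ i ∈ S, f i * ‖∑ j ∈ S, f j • p j - p i‖ ^ 2 := by
  have expand (y : E) : ∑ i ∈ S, f i * ‖y - p i‖ ^ 2 =
      ‖y‖ ^ 2 - 2 * inner ℝ y (∑ i ∈ S, f i • p i) + ∑ i ∈ S, f i * ‖p i‖ ^ 2 := by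
    simp only [norm_sub_sq_real, mul_add, mul_sub, sum_add_distrib, sum_sub_distrib, ← sum_mul, hf,
      inner_sum, inner_smul_right, mul_sum]
    simp only [one_mul, mul_left_comm]
  rw [expand, expand, norm_sub_sq_real, real_inner_self_eq_norm_sq]
  ring

theorem sum_smul_eq_sum_smul_of_sum_mul_norm_sub_sq {S T : Finset ι} {f g : ι → ℝ} {a : ℝ}
    (hf : ∑ i ∈ S, f i = 1) (hg : ∑ i ∈ T, g i = 1)
    (hS : ∀ k ∈ S, ∑ i ∈ T, g i * ‖p k - p i‖ ^ 2 = a + ∑ i ∈ S, f i * ‖p k - p i‖ ^ 2)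
    (hT : ∀ k ∈ T, ∑ i ∈ T, g i * ‖p k - p i‖ ^ 2 = a + ∑ i ∈ S, f i * ‖p k - p i‖ ^ 2) :
    ∑ i ∈ S, f i • p i = ∑ i ∈ T, g i • p i := by
  simp only [sum_mul_norm_sub_sq hf (p _), sum_mul_norm_sub_sq hg (p _)] at hS hT
  set x := ∑ i ∈ S, f i • p i
  set y := ∑ i ∈ T, g i • p i
  -- `z ↦ ‖z - y‖² - ‖z - x‖²` is affine; being constant on the points, it agrees at `x` and `y`.
  have averageS := sum_congr rfl fun k hk => congrArg (f k * ·) (hS k hk)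
  have averageT := sum_congr rfl fun k hk => congrArg (g k * ·) (hT k hk)
  simp only [mul_add, sum_add_distrib, ← sum_mul, hf, hg, one_mul, norm_sub_rev (p _),
    sum_mul_norm_sub_sq hf y, sum_mul_norm_sub_sq hg x] at averageS averageT
  have hxy : ‖x - y‖ ^ 2 = 0 := by
    rw [norm_sub_rev y x] at averageS
    linarith
  simpa [sub_eq_zero] using hxy

end Geometry

namespace PartialMatrix

open Finset Module Submodule

variable {n d : ℕ} (M : PartialMatrix n)

/-- The entry `(i, j)` is specified. This relation is reflexive. -/
def Adj (i j : Fin n) : Prop :=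
  (M.entry i j).isSome

instance : DecidableRel M.Adj := fun _ _ => inferInstanceAs (Decidable (_ = true))

/-- The entries, with `0` in place of the unspecified ones. -/
def val (i j : Fin n) : ℝ :=
  (M.entry i j).getD 0

/-- The principal submatrix on `A` is a yes-instance. -/
def RealizableOn (d : ℕ) (A : Finset (Fin n)) : Prop :=
  ∃ p : Fin n → EuclideanSpace ℝ (Fin d),
    ∀ i ∈ A, ∀ j ∈ A, M.Adj i j → M.val i j = ‖p i - p j‖ ^ 2

variable {M} {A B C K S : Finset (Fin n)} {u v : Fin n}

theorem Adj.symm {i j : Fin n} (h : M.Adj i j) : M.Adj j i := by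
  rwa [Adj, M.symm]

theorem adj_self (i : Fin n) : M.Adj i i := by
  simp [Adj, M.diag]

theorem val_symm (i j : Fin n) : M.val i j = M.val j i := by
  rw [val, M.symm, val]

theorem val_self (i : Fin n) : M.val i i = 0 := by
  simp [val, M.diag]

theorem entry_eq_some_iff {i j : Fin n} {x : ℝ} :
    M.entry i j = some x ↔ M.Adj i j ∧ M.val i j = x := by
  unfold Adj val
  cases M.entry i j <;> simp

theorem ExcludesBlock.noBlock {t : ℕ} (h : M.ExcludesBlock t) : NoBlock M.Adj t := by
  intro I J hI hJ
  by_contra! hcon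
  refine h ⟨I, J, disjoint_left.2 fun i hi hj => hcon i hi i hj (adj_self i), hI, hJ, ?_⟩
  exact fun i hi j hj => by simpa [Adj] using hcon i hi j hj

theorem completable_principal_iff {m : ℕ} (f : Fin m ↪o Fin n) :
    (M.principal f).Completable d ↔ M.RealizableOn d (univ.map f.toEmbedding) := by
  constructor
  · rintro ⟨D, ⟨p, hp⟩, hD⟩
    refine ⟨Function.extend f p 0, ?_⟩
    simp only [forall_mem_map, RelEmbedding.coe_toEmbedding, f.injective.extend_apply, ← hp]
    exact fun i _ j _ h => (hD i j _ (entry_eq_some_iff.2 ⟨h, rfl⟩)).symm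
  · rintro ⟨p, hp⟩
    simp only [forall_mem_map] at hp
    refine ⟨_, ⟨p ∘ f, fun _ _ => rfl⟩, fun i j x h => ?_⟩
    obtain ⟨hij, hx⟩ := entry_eq_some_iff.1 h
    exact (hp i (mem_univ i) j (mem_univ j) hij).symm.trans hx

theorem completable_iff : M.Completable d ↔ M.RealizableOn d univ :=
  (completable_principal_iff (OrderIso.refl (Fin n)).toOrderEmbedding).trans (by simp)

theorem RealizableOn.mono (hAB : A ⊆ B) (h : M.RealizableOn d B) : M.RealizableOn d A := by
  obtain ⟨p, hp⟩ := h
  exact ⟨p, fun i hi j hj => hp i (hAB hi) j (hAB hj)⟩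

/-- The vector whose coordinates are those of `x.1` at the places in `C`, zero at the other places,
and finally `x.2`. -/
def bordered (C : Finset (Fin n)) : (Fin n → ℝ) × ℝ →ₗ[ℝ] EuclideanSpace ℝ (Fin (n + 1)) where
  toFun x := WithLp.toLp 2 (Fin.snoc (α := fun _ => ℝ) (fun k => if k ∈ C then x.1 k else 0) x.2)
  map_add' x y := by
    ext k
    refine Fin.lastCases (by simp) (fun k => ?_) k
    by_cases hk : k ∈ C <;> simp [hk]
  map_smul' a x := by
    ext k
    refine Fin.lastCases (by simp) (fun k => ?_) k
    by_cases hk : k ∈ C <;> simp [hk]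

theorem bordered_last (x : (Fin n → ℝ) × ℝ) : bordered C x (Fin.last n) = x.2 := by
  simp [bordered]

theorem bordered_castSucc (x : (Fin n → ℝ) × ℝ) (k : Fin n) :
    bordered C x k.castSucc = if k ∈ C then x.1 k else 0 := by
  simp [bordered]

theorem bordered_eq_iff {x y : (Fin n → ℝ) × ℝ} :
    bordered C x = bordered C y ↔ x.2 = y.2 ∧ ∀ k ∈ C, x.1 k = y.1 k := by
  constructor
  · intro h
    refine ⟨by simpa only [bordered_last] using congrArg (· (Fin.last n)) h, fun k hk => ?_⟩
    simpa only [bordered_castSucc, if_pos hk] using congrArg (· k.castSucc) h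
  · rintro ⟨hlast, hC⟩
    ext k
    refine Fin.lastCases (by simpa only [bordered_last]) (fun k => ?_) k
    by_cases hk : k ∈ C <;> simp [bordered_castSucc, hk, hC]

/-- The last column of the Cayley–Menger matrix, restricted to the rows in `C` and the last one. -/
def ones (C : Finset (Fin n)) : EuclideanSpace ℝ (Fin (n + 1)) :=
  bordered C (1, 0)

variable (M)

/-- Column `i` of the Cayley–Menger matrix, restricted to the rows in `C` and the last one. -/
def col (C : Finset (Fin n)) (i : Fin n) : EuclideanSpace ℝ (Fin (n + 1)) :=
  bordered C (fun k => M.val k i, 1)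

/-- The rank of the last column of the Cayley–Menger matrix and the columns in `S`, restricted to
the rows in `C` and the last one. -/
noncomputable def colRank (C S : Finset (Fin n)) : ℕ :=
  finrank ℝ (span ℝ (insert (ones C) (M.col C '' S)))

/-- Column `v` of the Cayley–Menger matrix is a combination of the last column and the columns in
`S`, on the rows in `C` and the last one. -/
def Dep (C S : Finset (Fin n)) (v : Fin n) : Prop :=
  M.col C v ∈ span ℝ (insert (ones C) (M.col C '' S))

variable {M}

theorem colRank_insert_le_iff : M.colRank C (insert v S) ≤ M.colRank C S ↔ M.Dep C S v := by
  rw [colRank, coe_insert, Set.image_insert_eq, Set.insert_comm]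
  exact finrank_span_insert_le_iff

theorem dep_iff : M.Dep C S v ↔ ∃ (f : Fin n → ℝ) (c : ℝ), ∑ i ∈ S, f i = 1 ∧
    ∀ k ∈ C, M.val k v = c + ∑ i ∈ S, f i * M.val k i := by
  have combination (f : Fin n → ℝ) (c : ℝ) :
      M.col C v = c • ones C + ∑ i ∈ S, f i • M.col C i ↔
        ∑ i ∈ S, f i = 1 ∧ ∀ k ∈ C, M.val k v = c + ∑ i ∈ S, f i * M.val k i := by
    simp only [col, ones, ← map_smul, ← map_sum, ← map_add, bordered_eq_iff]
    simp [Prod.fst_sum, Prod.snd_sum, eq_comm]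
  simp only [Dep, mem_span_insert, ← combination]
  constructor
  · rintro ⟨c, z, hz, h⟩
    obtain ⟨f, rfl⟩ := (mem_span_image_finset_iff_exists_fun' ℝ).1 hz
    exact ⟨f, c, h⟩
  · rintro ⟨f, c, h⟩
    exact ⟨c, _, (mem_span_image_finset_iff_exists_fun' ℝ).2 ⟨f, rfl⟩, h⟩

theorem RealizableOn.dep_insert (hA : M.RealizableOn d A) (hKA : K ⊆ A)
    (hK : ∀ i ∈ K, ∀ j ∈ K, M.Adj i j) (hu : u ∈ A) (hv : v ∈ K) (huv : M.Adj u v) (hS : S ⊆ K)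
    (huS : ∀ s ∈ S, M.Adj u s) (h : M.Dep K S v) : M.Dep (insert u K) S v := by
  obtain ⟨p, hp⟩ := hA
  rw [dep_iff] at h ⊢
  obtain ⟨f, c, hf, hc⟩ := h
  have sum_val {k} (hk : k ∈ A) (hkS : ∀ s ∈ S, M.Adj k s) :
      ∑ i ∈ S, f i * M.val k i = ∑ i ∈ S, f i * ‖p k - p i‖ ^ 2 :=
    sum_congr rfl fun i hi => by rw [hp k hk i (hKA (hS hi)) (hkS i hi)]
  have hKc {k} (hk : k ∈ K) : ‖p k - p v‖ ^ 2 = c + ∑ i ∈ S, f i * ‖p k - p i‖ ^ 2 := by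
    rw [← hp k (hKA hk) v (hKA hv) (hK k hk v hv), hc k hk,
      sum_val (hKA hk) fun s hs => hK k hk s (hS hs)]
  -- On the points of a clique, the dependence is one between the points themselves.
  have hpv : ∑ i ∈ S, f i • p i = p v := by
    simpa using sum_smul_eq_sum_smul_of_sum_mul_norm_sub_sq (p := p) (T := {v}) (g := 1) (a := c) hf
      (by simp) (fun k hk => by simpa using hKc (hS hk)) (by simpa using hKc hv)
  refine ⟨f, c, hf, (forall_mem_insert ..).2 ⟨?_, hc⟩⟩
  have hcv := hKc hv
  rw [hp u hu v (hKA hv) huv, sum_val hu huS, sum_mul_norm_sub_sq hf, hpv]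
  simp only [sub_self, norm_zero] at hcv
  linarith

theorem val_eq_norm_sub_sq {p : Fin n → EuclideanSpace ℝ (Fin d)} {f : Fin n → ℝ} {c : ℝ}
    (hf : ∑ i ∈ S, f i = 1) (hvS : M.val v v = c + ∑ i ∈ S, f i * M.val v i)
    (hS : ∀ k ∈ insert u S, M.val k v = c + ∑ i ∈ S, f i * ‖p k - p i‖ ^ 2) :
    M.val u v = ‖p u - ∑ i ∈ S, f i • p i‖ ^ 2 := by
  simp only [sum_mul_norm_sub_sq hf (p _), forall_mem_insert] at hS
  set x := ∑ i ∈ S, f i • p i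
  -- Averaging the equations for `k ∈ S` evaluates the one for `v`, and determines `c`.
  have average : ∑ i ∈ S, f i * M.val v i =
      c + 2 * ∑ i ∈ S, f i * ‖x - p i‖ ^ 2 := by
    rw [sum_congr rfl fun k hk => by rw [val_symm, hS.2 k hk]]
    simp only [mul_add, sum_add_distrib, ← sum_mul, hf, norm_sub_rev (p _) x]
    ring
  rw [val_self] at hvS
  linarith [hS.1]

theorem RealizableOn.of_erase (hKA : K ⊆ A) (hK : ∀ i ∈ K, ∀ j ∈ K, M.Adj i j) (hv : v ∈ K)
    (hdep : ∀ u ∈ A, M.Adj u v → M.Dep (insert u K) {s ∈ K | M.Adj u s ∧ s ≠ v} v)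
    (h : M.RealizableOn d (A.erase v)) : M.RealizableOn d A := by
  obtain ⟨p, hp⟩ := h
  simp only [dep_iff] at hdep
  choose! f c hf hc using hdep
  have realized {k i} (hk : k ∈ A) (hkv : k ≠ v) (hi : i ∈ K) (hiv : i ≠ v) (hki : M.Adj k i) :
      M.val k i = ‖p k - p i‖ ^ 2 :=
    hp k (mem_erase.2 ⟨hkv, hk⟩) i (mem_erase.2 ⟨hiv, hKA hi⟩) hki
  have val_v {u} (hu : u ∈ A) (huv : M.Adj u v) {k} (hk : k ∈ insert u K) (hkv : k ≠ v) :
      M.val k v = c u + ∑ i ∈ K with M.Adj u i ∧ i ≠ v, f u i * ‖p k - p i‖ ^ 2 := by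
    rw [hc u hu huv k hk]
    refine congrArg _ (sum_congr rfl fun i hi => congrArg _ ?_)
    obtain ⟨hiK, hui, hiv⟩ := mem_filter.1 hi
    rcases mem_insert.1 hk with rfl | hk
    exacts [realized hu hkv hiK hiv hui, realized (hKA hk) hkv hiK hiv (hK k hk i hiK)]
  have hvA := hKA hv
  -- The place of `v` is the same combination of the neighbours of `u`, whichever `u` is taken.
  set q := ∑ i ∈ K with M.Adj v i ∧ i ≠ v, f v i • p i
  have combination_eq {u} (hu : u ∈ A) (huv : M.Adj u v) :
      ∑ i ∈ K with M.Adj u i ∧ i ≠ v, f u i • p i = q := by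
    have agree {k} (hk : k ∈ K) (hkv : k ≠ v) :=
      (val_v hu huv (mem_insert_of_mem hk) hkv).symm.trans
        (val_v hvA (adj_self v) (mem_insert_of_mem hk) hkv)
    refine (sum_smul_eq_sum_smul_of_sum_mul_norm_sub_sq (a := c u - c v)
      (hf u hu huv) (hf v hvA (adj_self v)) ?_ ?_) <;>
    · intro k hk
      obtain ⟨hkK, -, hkv⟩ := mem_filter.1 hk
      linarith [agree hkK hkv]
  have val_q {u} (hu : u ∈ A) (huv : M.Adj u v) (hne : u ≠ v) : M.val u v = ‖p u - q‖ ^ 2 := by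
    rw [← combination_eq hu huv]
    refine val_eq_norm_sub_sq (hf u hu huv) (hc u hu huv v (mem_insert_of_mem hv)) fun k hk => ?_
    refine val_v hu huv (insert_subset_insert u (filter_subset _ _) hk) ?_
    rcases mem_insert.1 hk with rfl | hk
    exacts [hne, (mem_filter.1 hk).2.2]
  refine ⟨Function.update p v q, fun i hi j hj hij => ?_⟩
  by_cases hiv : i = v <;> by_cases hjv : j = v
  · simp [hiv, hjv, val_self]
  · simpa [hiv, hjv, val_symm v, norm_sub_rev q] using val_q hj (hiv ▸ hij.symm) hjv
  · simpa [hiv, hjv] using val_q hi (hjv ▸ hij) hiv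
  · simpa [hiv, hjv] using hp i (mem_erase.2 ⟨hiv, hi⟩) j (mem_erase.2 ⟨hjv, hj⟩) hij

theorem RealizableOn.colRank_le (hA : M.RealizableOn d A) (hKA : K ⊆ A)
    (hK : ∀ i ∈ K, ∀ j ∈ K, M.Adj i j) : M.colRank K K ≤ d + 2 := by
  obtain ⟨p, hp⟩ := hA
  -- `‖p k - p i‖² = ‖p i‖² * 1 + 1 * ‖p k‖² + ∑ j, p i j * (-2 * p k j)`
  let z : Option (Option (Fin d)) → (Fin n → ℝ) × ℝ
    | none => (1, 0)
    | some none => (fun k => ‖p k‖ ^ 2, 1)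
    | some (some j) => (fun k => -2 * p k j, 0)
  have col_eq (i) (hi : i ∈ K) : M.col K i = ‖p i‖ ^ 2 • bordered K (z none) +
      bordered K (z (some none)) + ∑ j, p i j • bordered K (z (some (some j))) := by
    simp only [col, ← map_smul, ← map_sum, ← map_add, bordered_eq_iff]
    refine ⟨by simp [z, Prod.snd_sum], fun k hk => ?_⟩
    rw [hp k (hKA hk) i (hKA hi) (hK k hk i hi), norm_sub_sq_real, PiLp.inner_apply]
    simp only [z, Prod.fst_add, Prod.fst_sum, Prod.smul_fst, Pi.add_apply, Finset.sum_apply,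
      Pi.smul_apply, Pi.one_apply, smul_eq_mul, RCLike.inner_apply, conj_trivial, mul_sum]
    rw [sum_congr rfl fun j _ => show p i j * (-2 * p k j) = -(2 * (p i j * p k j)) by ring,
      sum_neg_distrib]
    ring
  have mem (o) : bordered K (z o) ∈ span ℝ (Set.range (bordered K ∘ z)) :=
    subset_span (Set.mem_range_self o)
  have hle : span ℝ (insert (ones K) (M.col K '' K)) ≤ span ℝ (Set.range (bordered K ∘ z)) := by
    rw [span_le]
    rintro _ (rfl | ⟨i, hi, rfl⟩)
    · exact mem none
    · rw [col_eq i hi]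
      exact add_mem (add_mem (smul_mem _ _ (mem none)) (mem (some none)))
        (sum_mem fun j _ => smul_mem _ _ (mem (some (some j))))
  refine (finrank_mono hle).trans ((finrank_range_le_card _).trans ?_)
  simp

/-- The bound on the size of the compressed instance. -/
def Bounded (M : PartialMatrix n) (d m : ℕ) : Prop :=
  ∀ t, 1 ≤ t → M.ExcludesBlock t → m ≤ (d + 1) ^ (20 * t ^ 2)

theorem Bounded.mono {m m' : ℕ} (hm : m ≤ m') (h : M.Bounded d m') : M.Bounded d m :=
  fun t ht hM => hm.trans (h t ht hM)

end PartialMatrix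

/-! ### Large cliques -/

open Finset in
theorem NoBlock.card_mul_le_of_forall_card_le {V : Type*} {adj : V → V → Prop} [DecidableRel adj]
    {t L m i : ℕ} {X : Finset V} {b : V} (h : NoBlock adj t) (ht : t ≠ 0)
    (hm : 2 * t * (8 * L) ^ t < m) (hXm : #X ≤ m) (hi : i < L)
    (hX : m * (2 * L - i) ≤ 2 * L * #X)
    (hmax : ∀ x ∈ X, #{y ∈ X | adj x y} ≤ #{y ∈ X | adj b y}) :
    m * (2 * L - (i + 1)) ≤ 2 * L * (#{y ∈ X | adj b y} - 1) := by
  have h8 : 8 * L ≤ (8 * L) ^ t := Nat.le_self_pow ht _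
  have hXbig : t * (8 * L) ^ t < #X := by
    have h₁ : m * L ≤ m * (2 * L - i) := Nat.mul_le_mul_left _ (by omega)
    have h₂ : m ≤ 2 * #X := Nat.le_of_mul_le_mul_left (c := L) (by nlinarith) (by omega)
    nlinarith
  obtain ⟨b₀, hb₀, hfew⟩ := h.exists_few_nonadj ht hXbig
  have hb := hmax b₀ hb₀
  have hsplit : #{y ∈ X | adj b₀ y} + #{y ∈ X | ¬ adj b₀ y} = #X :=
    card_filter_add_card_filter_not _
  set a := #{y ∈ X | ¬ adj b₀ y}
  obtain ⟨g, hg⟩ : ∃ g, #{y ∈ X | adj b y} - 1 = g := ⟨_, rfl⟩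
  rw [hg]
  have hle : 4 * L * #X ≤ 4 * L * g + 4 * L + 4 * L * a := by
    have : #X ≤ g + 1 + a := by omega
    nlinarith
  have hstep : m * (2 * L - i) = m * (2 * L - (i + 1)) + m := by
    rw [← Nat.mul_succ]
    congr 1
    omega
  have h16 : 16 * L ≤ m := by
    have : 2 * 1 * (8 * L) ≤ 2 * t * (8 * L) ^ t := by gcongr; omega
    omega
  linarith

namespace PartialMatrix

open Finset

variable {n d : ℕ} (M : PartialMatrix n) {A K X : Finset (Fin n)} {b u v : Fin n} {i : ℕ}

/-- The neighbours of `u` in `K` other than `v`. -/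
def nbrs (K : Finset (Fin n)) (u v : Fin n) : Finset (Fin n) :=
  {s ∈ K | M.Adj u s ∧ s ≠ v}

/-- The distances from `v` to its neighbours in `A` are determined by those from the points of the
clique `K`, and consistently so. -/
def Redundant (A K : Finset (Fin n)) (v : Fin n) : Prop :=
  ∀ u ∈ A, M.Adj u v → M.Dep (insert u K) (M.nbrs K u v) v

/-- A clique in `A` that is large enough for the bound on the number of rows. -/
structure IsLargeClique (A K : Finset (Fin n)) : Prop where
  subset : K ⊆ A
  adj : ∀ i ∈ K, ∀ j ∈ K, M.Adj i j
  le_card {t L : ℕ} : t ≠ 0 → L ≠ 0 → NoBlock M.Adj t → 2 * t * (8 * L) ^ t < #A → L ≤ #K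

/-- An invariant of the greedy construction of a clique in `A`. After `i` steps, the clique is `K`,
and `X` is a set of common neighbours of its points. -/
structure IsGreedyClique (A K X : Finset (Fin n)) (i : ℕ) : Prop where
  subset : K ∪ X ⊆ A
  disjoint : Disjoint K X
  adj : ∀ i ∈ K, ∀ j ∈ K ∪ X, M.Adj i j
  le_card {t L : ℕ} : t ≠ 0 → L ≠ 0 → NoBlock M.Adj t → 2 * t * (8 * L) ^ t < #A →
    min i L ≤ #K ∧ (i ≤ L → #A * (2 * L - i) ≤ 2 * L * #X)

variable {M}

theorem IsGreedyClique.zero : M.IsGreedyClique A ∅ A 0 where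
  subset := by simp
  disjoint := disjoint_empty_left A
  adj := by simp
  le_card _ _ _ _ := ⟨by simp, fun _ => by rw [Nat.sub_zero, mul_comm]⟩

theorem IsGreedyClique.isLargeClique (h : M.IsGreedyClique A K X n) : M.IsLargeClique A K where
  subset := subset_union_left.trans h.subset
  adj i hi j hj := h.adj i hi j (mem_union_left X hj)
  le_card {t L} ht hL hM hA := by
    have hn : #A ≤ n := card_finset_fin_le A
    have hLA : L ≤ 2 * t * (8 * L) ^ t :=
      calc L ≤ 8 * L := by omega
        _ ≤ (8 * L) ^ t := Nat.le_self_pow ht _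
        _ ≤ 2 * t * (8 * L) ^ t := Nat.le_mul_of_pos_left _ (by omega)
    have := (h.le_card ht hL hM hA).1
    omega

theorem IsGreedyClique.succ_of_empty (h : M.IsGreedyClique A K ∅ i) :
    M.IsGreedyClique A K ∅ (i + 1) := by
  refine ⟨h.subset, h.disjoint, h.adj, fun {t L} ht hL hM hA => ?_⟩
  obtain ⟨hK, hX⟩ := h.le_card ht hL hM hA
  have hiL : L ≤ i := by
    by_contra! hlt
    have hpos : 0 < #A * (2 * L - i) := Nat.mul_pos (by omega) (by omega)
    simpa using hpos.trans_le (hX hlt.le)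
  exact ⟨by omega, fun _ => by omega⟩

theorem IsGreedyClique.succ (h : M.IsGreedyClique A K X i) (hb : b ∈ X)
    (hmax : ∀ x ∈ X, #{y ∈ X | M.Adj x y} ≤ #{y ∈ X | M.Adj b y}) :
    M.IsGreedyClique A (insert b K) (M.nbrs X b b) (i + 1) := by
  have hbK : b ∉ K := disjoint_right.1 h.disjoint hb
  have nbrs_eq : M.nbrs X b b = {y ∈ X | M.Adj b y}.erase b := by
    ext y
    simp only [nbrs, mem_filter, mem_erase]
    tauto
  refine ⟨?_, ?_, ?_, fun {t L} ht hL hM hA => ?_⟩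
  · refine (union_subset (insert_subset (mem_union_right K hb) subset_union_left) ?_).trans h.subset
    exact (filter_subset _ _).trans subset_union_right
  · exact (disjoint_insert_left.2 ⟨by simp [nbrs], h.disjoint.mono_right (filter_subset _ _)⟩)
  · have hKb (k) (hk : k ∈ K) : M.Adj k b := h.adj k hk b (mem_union_right K hb)
    simp only [nbrs, mem_union, mem_insert, mem_filter]
    rintro x (rfl | hx) y ((rfl | hy) | ⟨hy, hby, -⟩)
    exacts [adj_self _, (hKb y hy).symm, hby, hKb x hx, h.adj x hx y (mem_union_left X hy),
      h.adj x hx y (mem_union_right K hy)]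
  · obtain ⟨hK, hX⟩ := h.le_card ht hL hM hA
    rw [card_insert_of_notMem hbK, nbrs_eq, card_erase_of_mem (by simp [hb, adj_self])]
    refine ⟨by omega, fun hi => hM.card_mul_le_of_forall_card_le ht hA
      (card_le_card (subset_union_right.trans h.subset)) hi (hX (by omega)) hmax⟩

theorem Redundant.erase_nonempty (h : M.Redundant A K v) (hKA : K ⊆ A) (hv : v ∈ K) :
    (A.erase v).Nonempty := by
  obtain ⟨f, -, hf, -⟩ := dep_iff.1 (h v (hKA hv) (adj_self v))
  obtain ⟨s, hs, -⟩ := exists_ne_zero_of_sum_ne_zero (hf.trans_ne one_ne_zero)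
  obtain ⟨hsK, -, hsv⟩ := mem_filter.1 hs
  exact ⟨s, mem_erase.2 ⟨hsv, hKA hsK⟩⟩

theorem IsLargeClique.bounded (h : M.IsLargeClique A K) (hd : d ≠ 0)
    (hrank : M.colRank K K ≤ d + 2)
    (hdep : ∀ v ∈ K, ∃ u, M.Adj u v ∧ ¬ M.Dep K (M.nbrs K u v) v) : M.Bounded d #A := by
  intro t ht hM
  have ht : t ≠ 0 := Nat.one_le_iff_ne_zero.1 ht
  refine compression_bound hd ht ?_
  by_contra! hcon
  have hlarge := h.le_card ht (Nat.succ_ne_zero _) hM.noBlock hcon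
  have hsmall := hM.noBlock.card_le_of_notMem_span ht (D := d + 2) (Nat.succ_ne_zero _) hrank
    (by simpa [Dep, nbrs] using hdep)
  omega

end PartialMatrix

section GramSchmidt

open InnerProductSpace Module Submodule

variable {𝕜 E ι : Type*} [RCLike 𝕜] [NormedAddCommGroup E] [InnerProductSpace 𝕜 E] [LinearOrder ι]
  [LocallyFiniteOrderBot ι] [WellFoundedLT ι]

theorem card_gramSchmidt_ne_zero [Fintype ι] (f : ι → E)
    [DecidablePred fun i => gramSchmidt 𝕜 f i ≠ 0] :
    (Finset.univ.filter fun i => gramSchmidt 𝕜 f i ≠ 0).card =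
      finrank 𝕜 (span 𝕜 (Set.range f)) := by
  have hli : LinearIndependent 𝕜 fun i : {i // gramSchmidt 𝕜 f i ≠ 0} => gramSchmidt 𝕜 f i :=
    linearIndependent_of_ne_zero_of_inner_eq_zero (fun i => i.2) fun i j hij =>
      gramSchmidt_orthogonal 𝕜 f (Subtype.coe_ne_coe.2 hij)
  have hspan : span 𝕜 (Set.range fun i : {i // gramSchmidt 𝕜 f i ≠ 0} => gramSchmidt 𝕜 f i) =
      span 𝕜 (Set.range f) := by
    rw [← span_gramSchmidt 𝕜 f, ← span_sdiff_singleton_zero (s := Set.range (gramSchmidt 𝕜 f))]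
    congr 1
    ext x
    constructor
    · rintro ⟨i, rfl⟩
      exact ⟨⟨i, rfl⟩, i.2⟩
    · rintro ⟨⟨i, rfl⟩, hi⟩
      exact ⟨⟨i, hi⟩, rfl⟩
  rw [← hspan, finrank_span_eq_card hli, Fintype.card_subtype]

theorem gramSchmidt_apply {m : ℕ} (f : ι → EuclideanSpace ℝ (Fin m)) (i : ι) (k : Fin m) :
    gramSchmidt ℝ f i k = f i k - ∑ j ∈ Finset.Iio i,
      (∑ l, f i l * gramSchmidt ℝ f j l) / (∑ l, gramSchmidt ℝ f j l ^ 2) *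
        gramSchmidt ℝ f j k := by
  simp [gramSchmidt_def ℝ f i, starProjection_singleton, PiLp.inner_apply,
    EuclideanSpace.real_norm_sq_eq]

end GramSchmidt

/-! ### Structured programs -/

namespace RealRAM

@[simp]
theorem State.nat_setNat (s : State) (a i j x a' i' j' : ℕ) :
    (s.setNat a i j x).nat a' i' j' = if a' = a ∧ i' = i ∧ j' = j then x else s.nat a' i' j' :=
  rfl

@[simp]
theorem State.real_setNat (s : State) (a i j x : ℕ) : (s.setNat a i j x).real = s.real :=
  rfl

@[simp]
theorem State.nat_setReal (s : State) (a i j : ℕ) (x : ℝ) : (s.setReal a i j x).nat = s.nat :=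
  rfl

@[simp]
theorem State.real_setReal (s : State) (a i j : ℕ) (x : ℝ) (a' i' j' : ℕ) :
    (s.setReal a i j x).real a' i' j' =
      if a' = a ∧ i' = i ∧ j' = j then x else s.real a' i' j' :=
  rfl

theorem State.nat_setNat_of_ne (s : State) {a b : ℕ} (h : b ≠ a) (i j x : ℕ) :
    (s.setNat a i j x).nat b = s.nat b := by
  funext i' j'
  simp [h]

theorem State.real_setReal_of_ne (s : State) {a b : ℕ} (h : b ≠ a) (i j : ℕ) (x : ℝ) :
    (s.setReal a i j x).real b = s.real b := by
  funext i' j'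
  simp [h]

attribute [simp] NatExpr.eval RealExpr.eval Cond.Holds

/-- Structured programs: the only loops are `forN c a p`, which runs `p` with the counter in cell
`(0, 0)` of the `a`-th array going through the numbers below `n + c`, where `n` is the content of
cell `(0, 0)` of array `0`. -/
inductive Code where
  | skip
  | setN (a : ℕ) (i j : NatExpr) (e : NatExpr)
  | setR (a : ℕ) (i j : NatExpr) (e : RealExpr)
  | seq (p q : Code)
  | ite (c : Cond) (p q : Code)
  | forN (c a : ℕ) (p : Code)

namespace Code

open Polynomial

notation:60 p:61 ";;" q:60 => Code.seq p q

/-- The natural number in cell `(0, 0)` of an array, which serves as a scalar variable. -/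
abbrev var (a : ℕ) : NatExpr := .cell a (.const 0) (.const 0)

/-- The real number in cell `(0, 0)` of an array, which serves as a scalar variable. -/
abbrev rvar (a : ℕ) : RealExpr := .cell a (.const 0) (.const 0)

/-- Assignment to a scalar variable. -/
abbrev letN (a : ℕ) (e : NatExpr) : Code := setN a (.const 0) (.const 0) e

/-- Assignment to a real scalar variable. -/
abbrev letR (a : ℕ) (e : RealExpr) : Code := setR a (.const 0) (.const 0) e

/-- Compilation to programs of the real RAM. -/
def toProg : Code → Prog
  | skip => .skip
  | setN a i j e => .setNat a i j e
  | setR a i j e => .setReal a i j e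
  | p ;; q => .seq p.toProg q.toProg
  | ite c p q => .ite c p.toProg q.toProg
  | forN c a p => .seq (.setNat a (.const 0) (.const 0) (.const 0))
      (.loop (.natLE (.add (var a) (.const 1)) (.add (var 0) (.const c)))
        (.seq p.toProg (.setNat a (.const 0) (.const 0) (.add (var a) (.const 1)))))

/-- The states that a counting loop with body `f` and counter `a` passes through. -/
def iter (a : ℕ) (f : State → State) (s : State) : ℕ → State
  | 0 => s.setNat a 0 0 0
  | i + 1 => (f (iter a f s i)).setNat a 0 0 (i + 1)

open Classical in
/-- The state in which a structured program halts. -/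
noncomputable def run : Code → State → State
  | skip, s => s
  | setN a i j e, s => s.setNat a (i.eval s) (j.eval s) (e.eval s)
  | setR a i j e, s => s.setReal a (i.eval s) (j.eval s) (e.eval s)
  | p ;; q, s => q.run (p.run s)
  | ite c p q, s => if c.Holds s then p.run s else q.run s
  | forN c a p, s => iter a p.run s (s.nat 0 0 0 + c)

@[simp]
theorem run_skip (s : State) : skip.run s = s :=
  rfl

@[simp]
theorem run_setN (a : ℕ) (i j e : NatExpr) (s : State) :
    (setN a i j e).run s = s.setNat a (i.eval s) (j.eval s) (e.eval s) :=
  rfl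

@[simp]
theorem run_setR (a : ℕ) (i j : NatExpr) (e : RealExpr) (s : State) :
    (setR a i j e).run s = s.setReal a (i.eval s) (j.eval s) (e.eval s) :=
  rfl

@[simp]
theorem run_seq (p q : Code) (s : State) : (p ;; q).run s = q.run (p.run s) :=
  rfl

open Classical in
@[simp]
theorem run_ite (c : Cond) (p q : Code) (s : State) :
    (ite c p q).run s = if c.Holds s then p.run s else q.run s :=
  rfl

/-- The arrays of natural numbers that a program may change. -/
def natWrites : Code → List ℕ
  | skip => []
  | setN a _ _ _ => [a]
  | setR _ _ _ _ => []
  | p ;; q => p.natWrites ++ q.natWrites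
  | ite _ p q => p.natWrites ++ q.natWrites
  | forN _ a p => a :: p.natWrites

/-- The arrays of real numbers that a program may change. -/
def realWrites : Code → List ℕ
  | skip => []
  | setN _ _ _ _ => []
  | setR a _ _ _ => [a]
  | p ;; q => p.realWrites ++ q.realWrites
  | ite _ p q => p.realWrites ++ q.realWrites
  | forN _ _ p => p.realWrites

/-- `p.Frame s t` holds if `s` and `t` agree on all arrays that `p` does not write. -/
structure Frame (p : Code) (s t : State) : Prop where
  nat {a : ℕ} : a ∉ p.natWrites → t.nat a = s.nat a
  real {a : ℕ} : a ∉ p.realWrites → t.real a = s.real a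

theorem Frame.rfl {p : Code} {s : State} : p.Frame s s :=
  ⟨fun _ => .refl _, fun _ => .refl _⟩

theorem Frame.trans {p : Code} {s t u : State} (h : p.Frame s t) (h' : p.Frame t u) :
    p.Frame s u :=
  ⟨fun ha => (h'.nat ha).trans (h.nat ha), fun ha => (h'.real ha).trans (h.real ha)⟩

theorem Frame.mono {p q : Code} {s t : State} (h : p.Frame s t)
    (hN : p.natWrites ⊆ q.natWrites) (hR : p.realWrites ⊆ q.realWrites) : q.Frame s t :=
  ⟨fun ha => h.nat (mt (@hN _) ha), fun ha => h.real (mt (@hR _) ha)⟩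

theorem Frame.setNat_counter (c a i : ℕ) (p : Code) (s : State) :
    (forN c a p).Frame s (s.setNat a 0 0 i) :=
  ⟨fun ha => s.nat_setNat_of_ne (List.ne_of_not_mem_cons ha) .., fun _ => .refl _⟩

theorem Frame.iter {c a : ℕ} {p : Code} {s : State} (hp : ∀ t, p.Frame t (p.run t)) (i : ℕ) :
    (forN c a p).Frame s (iter a p.run s i) := by
  induction i with
  | zero => exact .setNat_counter c a 0 p s
  | succ i ih =>
    exact (ih.trans ((hp _).mono (List.subset_cons_self _ _) (List.Subset.refl _))).trans
      (.setNat_counter c a (i + 1) p _)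

theorem frame_run (p : Code) (s : State) : p.Frame s (p.run s) := by
  induction p generalizing s with
  | skip => exact .rfl
  | setN a i j e =>
    exact ⟨fun ha => s.nat_setNat_of_ne (by simpa [natWrites] using ha) .., fun _ => rfl⟩
  | setR a i j e =>
    exact ⟨fun _ => rfl, fun ha => s.real_setReal_of_ne (by simpa [realWrites] using ha) ..⟩
  | seq p q hp hq =>
    exact ((hp s).mono (List.subset_append_left _ _) (List.subset_append_left _ _)).trans
      ((hq _).mono (List.subset_append_right _ _) (List.subset_append_right _ _))
  | ite c p q hp hq =>
    rw [run_ite]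
    split_ifs
    · exact (hp s).mono (List.subset_append_left _ _) (List.subset_append_left _ _)
    · exact (hq s).mono (List.subset_append_right _ _) (List.subset_append_right _ _)
  | forN c a p hp => exact .iter hp _

theorem run_nat {p : Code} {s : State} {a : ℕ} (h : a ∉ p.natWrites) :
    (p.run s).nat a = s.nat a :=
  (p.frame_run s).nat h

theorem run_real {p : Code} {s : State} {a : ℕ} (h : a ∉ p.realWrites) :
    (p.run s).real a = s.real a :=
  (p.frame_run s).real h

@[simp]
theorem iter_counter (a : ℕ) (f : State → State) (s : State) (i : ℕ) :
    (iter a f s i).nat a 0 0 = i := by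
  cases i <;> simp [iter]

/-- Loop bodies change neither the counter nor the bound, and the bound is changed only by the
last command. -/
def WF : Code → Prop
  | p ;; q => p.WF ∧ q.WF ∧ 0 ∉ p.natWrites
  | ite _ p q => p.WF ∧ q.WF
  | forN _ a p => p.WF ∧ 0 ∉ a :: p.natWrites ∧ a ∉ p.natWrites
  | _ => True

instance decidableWF : DecidablePred WF
  | skip | setN .. | setR .. => inferInstanceAs (Decidable True)
  | p ;; q => @instDecidableAnd _ _ (decidableWF p) (@instDecidableAnd _ _ (decidableWF q) _)
  | ite _ p q => @instDecidableAnd _ _ (decidableWF p) (decidableWF q)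
  | forN _ _ p => @instDecidableAnd _ _ (decidableWF p) _

/-- A bound on the running time, as a polynomial in the content of cell `(0, 0)` of array `0`. -/
noncomputable def time : Code → ℕ[X]
  | skip => 1
  | setN _ i j e => C (i.cost + j.cost + e.cost + 1)
  | setR _ i j e => C (i.cost + j.cost + e.cost + 1)
  | p ;; q => p.time + q.time
  | ite c p q => C (c.cost + 1) + p.time + q.time
  | forN c _ p => (X + C c) * (p.time + C 20) + C 16

theorem exec_loop {c a T : ℕ} {p : Code} {s : State} (h0 : 0 ∉ a :: p.natWrites)
    (ha : a ∉ p.natWrites)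
    (hp : ∀ i, ∃ k, Exec p.toProg (iter a p.run s i) (p.run (iter a p.run s i)) k ∧ k ≤ T)
    {i j : ℕ} (hij : i + j = s.nat 0 0 0 + c) :
    ∃ k, Exec (.loop (.natLE (.add (var a) (.const 1)) (.add (var 0) (.const c)))
        (.seq p.toProg (.setNat a (.const 0) (.const 0) (.add (var a) (.const 1)))))
        (iter a p.run s i) ((forN c a p).run s) k ∧ k ≤ j * (T + 20) + 12 := by
  have bound (i : ℕ) : (iter a p.run s i).nat 0 = s.nat 0 :=
    (Frame.iter (c := c) p.frame_run i).nat h0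
  induction j generalizing i with
  | zero =>
    obtain rfl : i = s.nat 0 0 0 + c := hij
    exact ⟨_, .loop_false (by simp [bound]), by simp [Cond.cost, NatExpr.cost]⟩
  | succ j ih =>
    obtain ⟨k, hk, hkT⟩ := hp i
    obtain ⟨l, hl, hlT⟩ := ih (i := i + 1) (by omega)
    have step := Exec.seq hk (.setNat _ a (.const 0) (.const 0) (.add (var a) (.const 1)))
    simp only [NatExpr.eval, run_nat ha, iter_counter] at step
    refine ⟨_, .loop_true ?_ step hl, ?_⟩
    · simp only [Cond.Holds, NatExpr.eval, iter_counter, bound]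
      omega
    · simp only [Cond.cost, NatExpr.cost, Nat.succ_mul]
      omega

theorem exec_run {p : Code} (hp : p.WF) (s : State) :
    ∃ k, Exec p.toProg s (p.run s) k ∧ k ≤ p.time.eval (s.nat 0 0 0) := by
  induction p generalizing s with
  | skip => exact ⟨_, .skip s, by simp [time]⟩
  | setN a i j e => exact ⟨_, .setNat s a i j e, by simp [time]⟩
  | setR a i j e => exact ⟨_, .setReal s a i j e, by simp [time]⟩
  | seq p q ihp ihq =>
    obtain ⟨hp, hq, h0⟩ := hp
    obtain ⟨k, hk, hkT⟩ := ihp hp s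
    obtain ⟨l, hl, hlT⟩ := ihq hq (p.run s)
    rw [run_nat h0] at hlT
    exact ⟨_, .seq hk hl, by simpa only [time, eval_add] using add_le_add hkT hlT⟩
  | ite c p q ihp ihq =>
    by_cases h : c.Holds s
    · obtain ⟨k, hk, hkT⟩ := ihp hp.1 s
      refine ⟨_, by simpa only [toProg, run_ite, if_pos h] using Exec.ite_true h hk, ?_⟩
      simp only [time, eval_add, eval_C]
      omega
    · obtain ⟨k, hk, hkT⟩ := ihq hp.2 s
      refine ⟨_, by simpa only [toProg, run_ite, if_neg h] using Exec.ite_false h hk, ?_⟩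
      simp only [time, eval_add, eval_C]
      omega
  | forN c a p ih =>
    obtain ⟨hp, h0, ha⟩ := hp
    have body (i : ℕ) := ih hp (iter a p.run s i)
    simp only [(Frame.iter (c := c) p.frame_run _).nat h0] at body
    obtain ⟨k, hk, hkT⟩ := exec_loop h0 ha body (zero_add (s.nat 0 0 0 + c))
    refine ⟨_, .seq (.setNat ..) hk, ?_⟩
    simp only [time, eval_add, eval_mul, eval_C, eval_X, NatExpr.cost]
    omega

theorem forN_induction {n c a : ℕ} {p : Code} {s : State} (I : ℕ → State → Prop)
    (hn : s.nat 0 0 0 = n) (zero : I 0 (s.setNat a 0 0 0))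
    (succ : ∀ (i : Fin (n + c)) t, (forN c a p).Frame s t → t.nat a 0 0 = i → I i t →
      I (i + 1) ((p.run t).setNat a 0 0 (i + 1))) :
    I (n + c) ((forN c a p).run s) := by
  subst hn
  have key (i : ℕ) (hi : i ≤ s.nat 0 0 0 + c) : I i (iter a p.run s i) := by
    induction i with
    | zero => exact zero
    | succ i ih =>
      exact succ ⟨i, hi⟩ _ (.iter p.frame_run i) (iter_counter ..) (ih (Nat.le_of_succ_le hi))
  exact key _ le_rfl

theorem seq_forN_induction {n c a : ℕ} {p q : Code} {s : State} (I : ℕ → State → Prop)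
    (hn : s.nat 0 0 0 = n) (h0 : 0 ∉ q.natWrites) (zero : I 0 ((q.run s).setNat a 0 0 0))
    (succ : ∀ (i : Fin (n + c)) t, (q.seq (forN c a p)).Frame s t → t.nat a 0 0 = i → I i t →
      I (i + 1) ((p.run t).setNat a 0 0 (i + 1))) :
    I (n + c) ((q.seq (forN c a p)).run s) := by
  refine forN_induction I (by rw [run_nat h0, hn]) zero fun i t hf => succ i t ?_
  exact ((frame_run q s).mono (List.subset_append_left _ _) (List.subset_append_left _ _)).trans
    (hf.mono (List.subset_append_right _ _) (List.subset_append_right _ _))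

end Code

end RealRAM

namespace RealRAM

namespace Code

variable {n : ℕ} {s : State}

/-- Sets variable `dst` to the sum of `e` over the values of the variable `k` below `n + c`. -/
def sum (dst c k : ℕ) (e : RealExpr) : Code :=
  letR dst (.ofNat (.const 0)) ;; forN c k (letR dst (.add (rvar dst) e))

theorem run_sum {dst c k : ℕ} {e : RealExpr} (g : Fin (n + c) → ℝ) (hn : s.nat 0 0 0 = n)
    (he : ∀ t (i : Fin (n + c)), (sum dst c k e).Frame s t → t.nat k 0 0 = i → e.eval t = g i) :
    ((sum dst c k e).run s).real dst 0 0 = ∑ i, g i := by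
  set g' : ℕ → ℝ := Function.extend Fin.val g 0
  have hg' (i : Fin (n + c)) : g' i = g i := Fin.val_injective.extend_apply g 0 i
  simp only [← hg', Fin.sum_univ_eq_sum_range g']
  refine seq_forN_induction (fun m t => t.real dst 0 0 = ∑ i ∈ Finset.range m, g' i) hn
    (by simp [natWrites]) (by simp) fun i t hf hk ht => ?_
  rw [Finset.sum_range_succ, ← ht, hg', ← he t i hf hk]
  simp

/-- Sets variable `dst` to the number of values of the variable `k` below `n + c` for which `b`
holds after `p`. -/
def count (dst c k : ℕ) (p : Code) (b : Cond) : Code :=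
  letN dst (.const 0) ;; forN c k (p ;; ite b (letN dst (.add (var dst) (.const 1))) skip)

theorem run_count {dst c k : ℕ} {p : Code} {b : Cond} (A : Finset (Fin (n + c)))
    (hn : s.nat 0 0 0 = n) (hdst : dst ∉ 0 :: k :: p.natWrites)
    (hb : ∀ t (i : Fin (n + c)), (count dst c k p b).Frame s t → t.nat k 0 0 = i →
      (b.Holds (p.run t) ↔ i ∈ A)) :
    ((count dst c k p b).run s).nat dst 0 0 = A.card := by
  set g : ℕ → ℕ := Function.extend Fin.val (fun i => if i ∈ A then 1 else 0) 0
  have hg (i : Fin (n + c)) : g i = if i ∈ A then 1 else 0 := Fin.val_injective.extend_apply _ 0 i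
  simp only [List.mem_cons, not_or] at hdst
  have hcard : A.card = ∑ i ∈ Finset.range (n + c), g i := by
    simp [← Fin.sum_univ_eq_sum_range g, hg]
  rw [hcard]
  refine seq_forN_induction (fun m t => t.nat dst 0 0 = ∑ i ∈ Finset.range m, g i) hn
    (by simpa [natWrites] using Ne.symm hdst.1) (by simp [hdst]) fun i t hf hk ht => ?_
  have hb := hb t i hf hk
  rw [Finset.sum_range_succ, ← ht, hg]
  by_cases h : i ∈ A <;> simp [h, hb, hdst, run_nat]

/-- Searches for a value of the variable `k` below `n` for which `b` holds after `p`. The result in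
variable `dst` is `0` if there is none, and otherwise the successor of the first one. -/
def find (dst k : ℕ) (p : Code) (b : Cond) : Code :=
  letN dst (.const 0) ;;
  forN 0 k (p ;; ite (.conj (.natLE (var dst) (.const 0)) b)
    (letN dst (.add (var k) (.const 1))) skip)

theorem run_find {dst k : ℕ} {p : Code} {b : Cond} (P : Fin n → Prop)
    (hn : s.nat 0 0 0 = n) (hdst : dst ∉ 0 :: k :: p.natWrites) (hk : k ∉ p.natWrites)
    (hb : ∀ t (i : Fin n), (find dst k p b).Frame s t → t.nat k 0 0 = i →
      (b.Holds (p.run t) ↔ P i)) :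
    ((find dst k p b).run s).nat dst 0 0 = 0 ∧ (∀ i, ¬ P i) ∨
      ∃ i, P i ∧ ((find dst k p b).run s).nat dst 0 0 = i + 1 := by
  simp only [List.mem_cons, not_or] at hdst
  suffices ((find dst k p b).run s).nat dst 0 0 = 0 ∧ (∀ i : Fin n, i < n + 0 → ¬ P i) ∨
      ∃ i, P i ∧ ((find dst k p b).run s).nat dst 0 0 = i + 1 by simpa using this
  refine seq_forN_induction (fun m t => t.nat dst 0 0 = 0 ∧ (∀ i : Fin n, i < m → ¬ P i) ∨
    ∃ i, P i ∧ t.nat dst 0 0 = i + 1) hn (by simpa [natWrites] using Ne.symm hdst.1)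
    (by simp [hdst]) fun i t hf hi ht => ?_
  have ht' : (p.run t).nat dst 0 0 = t.nat dst 0 0 := by rw [run_nat hdst.2.2]
  have hb := hb t i hf hi
  rcases ht with ⟨h0, hP⟩ | ⟨j, hj, hdj⟩
  · by_cases h : P i
    · refine .inr ⟨i, h, ?_⟩
      simp [ht', hb.2 h, h0, hdst, run_nat hk, hi]
    · refine .inl ⟨?_, fun j hj => ?_⟩
      · simp [ht', mt hb.1 h, h0, hdst]
      · rcases (Nat.lt_succ_iff.1 hj).lt_or_eq with hj | hj
        · exact hP j hj
        · exact Fin.ext hj ▸ h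
  · exact .inr ⟨j, hj, by simp [ht', hdj, hdst]⟩

theorem run_find_eq_zero {dst k : ℕ} {p : Code} {b : Cond} (P : Fin n → Prop)
    (hn : s.nat 0 0 0 = n) (hdst : dst ∉ 0 :: k :: p.natWrites) (hk : k ∉ p.natWrites)
    (hb : ∀ t (i : Fin n), (find dst k p b).Frame s t → t.nat k 0 0 = i →
      (b.Holds (p.run t) ↔ P i)) :
    ((find dst k p b).run s).nat dst 0 0 = 0 ↔ ∀ i, ¬ P i := by
  rcases run_find P hn hdst hk hb with ⟨h0, hP⟩ | ⟨i, hi, hdi⟩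
  · exact iff_of_true h0 hP
  · exact iff_of_false (by omega) fun h => h i hi

/-- Fills row `r` of the real array `dst` with the values of `e` after `p`, where the variable `k`
holds the column. -/
def fill (dst : ℕ) (r : NatExpr) (k : ℕ) (p : Code) (e : RealExpr) : Code :=
  forN 1 k (p ;; setR dst r (var k) e)

theorem run_fill {dst k r₀ : ℕ} {r : NatExpr} {p : Code} {e : RealExpr} (g : Fin (n + 1) → ℝ)
    (hn : s.nat 0 0 0 = n) (hdst : dst ∉ p.realWrites) (hk : k ∉ p.natWrites)
    (he : ∀ t (i : Fin (n + 1)), (fill dst r k p e).Frame s t → t.nat k 0 0 = i →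
      (∀ r', r' ≠ r₀ → t.real dst r' = s.real dst r') →
        r.eval (p.run t) = r₀ ∧ e.eval (p.run t) = g i) :
    (∀ i : Fin (n + 1), ((fill dst r k p e).run s).real dst r₀ i = g i) ∧
      ∀ r', r' ≠ r₀ → ((fill dst r k p e).run s).real dst r' = s.real dst r' := by
  suffices (∀ i : Fin (n + 1), i < n + 1 → ((fill dst r k p e).run s).real dst r₀ i = g i) ∧
      ∀ r', r' ≠ r₀ → ((fill dst r k p e).run s).real dst r' = s.real dst r' from
    ⟨fun i => this.1 i i.isLt, this.2⟩
  refine forN_induction (fun m t => (∀ i : Fin (n + 1), i < m → t.real dst r₀ i = g i) ∧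
    ∀ r', r' ≠ r₀ → t.real dst r' = s.real dst r') hn (by simp) fun i t hf hi ⟨hg, hr⟩ => ?_
  obtain ⟨her, heg⟩ := he t i hf hi hr
  refine ⟨fun j hj => ?_, fun r' hr' => ?_⟩
  · rcases (Nat.lt_succ_iff.1 hj).lt_or_eq with hj | hj
    · simp [her, heg, run_nat hk, run_real hdst, hi, hj.ne, hg j hj]
    · obtain rfl := Fin.ext hj
      simp [her, heg, run_nat hk, hi]
  · funext j
    simp [her, hr', run_real hdst, hr r' hr']

/-- Row `0` of the `a`-th array of natural numbers is the indicator function of `A`. -/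
def HoldsSet (s : State) (a : ℕ) (A : Finset (Fin n)) : Prop :=
  ∀ i : Fin n, s.nat a 0 i = if i ∈ A then 1 else 0

theorem HoldsSet.congr {a : ℕ} {A : Finset (Fin n)} {t : State} (h : HoldsSet s a A)
    (ht : t.nat a = s.nat a) : HoldsSet t a A :=
  fun i => by rw [ht, h i]

/-- The test whether `i` belongs to the set whose indicator function is row `0` of array `a`. -/
abbrev mem (a : ℕ) (i : NatExpr) : Cond :=
  .natLE (.const 1) (.cell a (.const 0) i)

theorem HoldsSet.mem_iff {a : ℕ} {A : Finset (Fin n)} (h : HoldsSet s a A) (i : Fin n) :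
    1 ≤ s.nat a 0 i ↔ i ∈ A := by
  rw [h i]
  split_ifs with hi <;> simp [hi]

/-- Stores the set of all values of the variable `k` below `n` for which `b` holds. -/
def mask (dst k : ℕ) (b : Cond) : Code :=
  forN 0 k (ite b (setN dst (.const 0) (var k) (.const 1)) (setN dst (.const 0) (var k) (.const 0)))

theorem run_mask {dst k : ℕ} {b : Cond} (A : Finset (Fin n)) (hn : s.nat 0 0 0 = n) (hdst : dst ≠ k)
    (hb : ∀ t (i : Fin n), (mask dst k b).Frame s t → t.nat k 0 0 = i →
      t.nat dst 0 i = s.nat dst 0 i → (b.Holds t ↔ i ∈ A)) :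
    HoldsSet ((mask dst k b).run s) dst A := by
  suffices (∀ i : Fin n, i < n + 0 → ((mask dst k b).run s).nat dst 0 i = if i ∈ A then 1 else 0) ∧
      ∀ j : Fin n, n + 0 ≤ j → ((mask dst k b).run s).nat dst 0 j = s.nat dst 0 j by
    simpa [HoldsSet] using this.1
  refine forN_induction (fun m t => (∀ i : Fin n, i < m → t.nat dst 0 i = if i ∈ A then 1 else 0) ∧
    ∀ j : Fin n, m ≤ j → t.nat dst 0 j = s.nat dst 0 j) hn (by simp [hdst])
    fun i t hf hi ⟨hlt, hle⟩ => ?_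
  have hb := hb t i hf hi (hle i le_rfl)
  refine ⟨fun j hj => ?_, fun j hj => ?_⟩
  · rcases (Nat.lt_succ_iff.1 hj).lt_or_eq with hj | hj
    · by_cases h : i ∈ A <;> simp [hdst, hb, h, hi, hj.ne, hlt j hj]
    · obtain rfl := Fin.ext hj
      by_cases h : j ∈ A <;> simp [hdst, hb, h, hi]
  · have hij : (j : ℕ) ≠ i := (Nat.lt_of_succ_le hj).ne'
    by_cases h : i ∈ A <;> simp [hdst, hb, h, hi, hij, hle j (Nat.le_of_succ_le hj)]

end Code

end RealRAM

/-! ### Ranks -/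

namespace RealRAM

namespace Code

open InnerProductSpace Module Submodule Finset

/-- The counter of the rows of an array. -/
abbrev row : ℕ := 10

/-- The counter of the columns of an array. -/
abbrev col : ℕ := 11

/-- The counter of the rows that have been orthogonalized already. -/
abbrev prev : ℕ := 12

/-- The array of natural numbers for a set `C` of rows of the bordered matrix. -/
abbrev rows : ℕ := 13

/-- The array of natural numbers for a set `S` of columns of the bordered matrix. -/
abbrev cols : ℕ := 14

/-- The variable for a rank. -/
abbrev rk : ℕ := 15

/-- The real array whose rows are the orthogonalized vectors. -/
abbrev orth : ℕ := 1

/-- The real array with the coefficients of a projection in row `0`. -/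
abbrev coef : ℕ := 2

/-- The real variable for the numerator of a coefficient. -/
abbrev num : ℕ := 3

/-- The real variable for the denominator of a coefficient, the squared norm of a vector. -/
abbrev den : ℕ := 4

/-- The real variable for an entry of a projection. -/
abbrev proj : ℕ := 5

/-- The entry at `col` of the vector with number `row`. -/
def entry : RealExpr :=
  .mul (.mul (.ofNat (.cell cols (.const 0) (var row))) (.ofNat (.cell rows (.const 0) (var col))))
    (.cell 0 (var col) (var row))

/-- Computes the squared norm of the row of `orth` whose number is in the variable `i`. -/
def normSq (i : ℕ) : Code :=
  sum den 1 col (.mul (.cell orth (var i) (var col)) (.cell orth (var i) (var col)))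

/-- Computes the inner product of the current vector with the row `prev` of `orth`. -/
def inner : Code :=
  sum num 1 col (.mul entry (.cell orth (var prev) (var col)))

/-- Computes the projection coefficients of the current vector on the rows of `orth`, where those
that have not been orthogonalized yet get the coefficient `0`. -/
def project : Code :=
  fill coef (.const 0) prev
    (inner ;; normSq prev ;;
      ite (.natLE (.add (var prev) (.const 1)) (var row)) skip (letR num (.ofNat (.const 0))))
    (.div (rvar num) (rvar den))

/-- Subtracts the projection from the current vector. -/
def subtract : Code :=
  fill orth (var row) col
    (sum proj 1 prev (.mul (.cell coef (.const 0) (var prev)) (.cell orth (var prev) (var col))))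
    (.sub entry (rvar proj))

/-- Gram–Schmidt orthogonalization. -/
def orthogonalize : Code :=
  forN 1 row (project ;; subtract)

/-- Computes the rank of a family of vectors, as the number of nonzero vectors that Gram–Schmidt
orthogonalization leaves. -/
def rank : Code :=
  orthogonalize ;; count rk 1 row (normSq row) (.neg (.realLE (rvar den) (.ofNat (.const 0))))

variable {n : ℕ} {s : State} {f : Fin (n + 1) → EuclideanSpace ℝ (Fin (n + 1))}

/-- The vectors whose entries are given by `entry` are those of the family `f`. -/
def HoldsFamily (s : State) (f : Fin (n + 1) → EuclideanSpace ℝ (Fin (n + 1))) : Prop :=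
  ∀ i k : Fin (n + 1), s.nat cols 0 i * s.nat rows 0 k * s.real 0 k i = f i k

theorem run_normSq {i r : ℕ} (v : EuclideanSpace ℝ (Fin (n + 1))) (hn : s.nat 0 0 0 = n)
    (hi : i ≠ col) (hr : s.nat i 0 0 = r) (hv : ∀ k : Fin (n + 1), s.real orth r k = v k) :
    ((normSq i).run s).real den 0 0 = ∑ k, v k ^ 2 := by
  refine run_sum _ hn fun t k hf hk => ?_
  have hti : t.nat i = s.nat i := hf.nat (by simpa [sum, natWrites] using hi)
  have hto : t.real orth = s.real orth := hf.real (by simp [sum, realWrites])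
  simp [hk, hti, hto, hr, hv, sq]

theorem run_inner (v : EuclideanSpace ℝ (Fin (n + 1))) (hn : s.nat 0 0 0 = n) (hf : HoldsFamily s f)
    {i j : Fin (n + 1)} (hi : s.nat row 0 0 = i) (hj : s.nat prev 0 0 = j)
    (hv : ∀ k : Fin (n + 1), s.real orth j k = v k) :
    (inner.run s).real num 0 0 = ∑ k, f i k * v k :=
  run_sum _ hn fun t k ht hk => by
    simp +decide [entry, ht.nat, ht.real, hk, hi, hj, hv, ← hf i k]

theorem HoldsFamily.congr {t : State} (h : HoldsFamily s f) (hrows : t.nat rows = s.nat rows)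
    (hcols : t.nat cols = s.nat cols) (hreal : t.real 0 = s.real 0) : HoldsFamily t f := by
  simpa only [HoldsFamily, hrows, hcols, hreal] using h

theorem run_project (hn : s.nat 0 0 0 = n) (hf : HoldsFamily s f) {i : Fin (n + 1)}
    (hi : s.nat row 0 0 = i)
    (horth : ∀ j < i, ∀ k : Fin (n + 1), s.real orth j k = gramSchmidt ℝ f j k) (j : Fin (n + 1)) :
    (project.run s).real coef 0 j = if j < i then
      (∑ l, f i l * gramSchmidt ℝ f j l) / (∑ l, gramSchmidt ℝ f j l ^ 2) else 0 := by
  refine (run_fill (r₀ := 0) (fun j => if j < i then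
      (∑ l, f i l * gramSchmidt ℝ f j l) / (∑ l, gramSchmidt ℝ f j l ^ 2) else 0)
      hn (by decide) (by decide) fun t j ht hj _ => ⟨rfl, ?_⟩).1 j
  have htn : t.nat 0 0 0 = n := by rw [ht.nat (by decide), hn]
  have hti : t.nat row 0 0 = i := by rw [ht.nat (by decide), hi]
  by_cases hji : j < i
  · have htj (k : Fin (n + 1)) : t.real orth j k = gramSchmidt ℝ f j k := by
      rw [ht.real (by decide), horth j hji]
    have hnum := run_inner _ htn
      (hf.congr (ht.nat (by decide)) (ht.nat (by decide)) (ht.real (by decide))) hti hj htj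
    have hden := run_normSq (s := inner.run t) (i := prev) (gramSchmidt ℝ f j)
      (by rw [run_nat (by decide), htn]) (by decide) (by rw [run_nat (by decide), hj])
      fun k => by rw [run_real (by decide), htj]
    simp +decide [run_nat, hji, hj, hti, hden, run_real, hnum]
  · simp +decide [run_nat, hji, hj, hti]

theorem run_subtract (hn : s.nat 0 0 0 = n) (hf : HoldsFamily s f) {i : Fin (n + 1)}
    (hi : s.nat row 0 0 = i) (hi₀ : s.real coef 0 i = 0) :
    (∀ k : Fin (n + 1), (subtract.run s).real orth i k =
      f i k - ∑ j : Fin (n + 1), s.real coef 0 j * s.real orth j k) ∧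
      ∀ r : ℕ, r ≠ i → (subtract.run s).real orth r = s.real orth r := by
  refine run_fill (fun k => f i k - ∑ j : Fin (n + 1), s.real coef 0 j * s.real orth j k)
    hn (by decide) (by decide) fun t k ht hk horth => ⟨?_, ?_⟩
  · simp +decide [run_nat, ht.nat, hi]
  · have hsum := run_sum (s := t) (dst := proj) (k := prev)
      (e := .mul (.cell coef (.const 0) (var prev)) (.cell orth (var prev) (var col)))
      (fun j : Fin (n + 1) => s.real coef 0 j * s.real orth j k)
      (by rw [ht.nat (by decide), hn]) fun t' j ht' hj => by
        rcases eq_or_ne j i with rfl | hji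
        · simp +decide [ht'.real, ht.real, hj, hi₀]
        · simp +decide [ht'.nat, ht'.real, ht.real, hk, hj, horth _ (Fin.val_ne_of_ne hji)]
    simp +decide [entry, run_nat, run_real, hsum, ht.nat, ht.real, hk, hi, ← hf i k]

theorem run_orthogonalize (hn : s.nat 0 0 0 = n) (hf : HoldsFamily s f) (i k : Fin (n + 1)) :
    (orthogonalize.run s).real orth i k = gramSchmidt ℝ f i k := by
  suffices ∀ i : Fin (n + 1), i < n + 1 → ∀ k : Fin (n + 1),
      (orthogonalize.run s).real orth i k = gramSchmidt ℝ f i k from this i i.isLt k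
  refine forN_induction (fun m t => ∀ i : Fin (n + 1), i < m → ∀ k : Fin (n + 1),
    t.real orth i k = gramSchmidt ℝ f i k) hn (by simp) fun i t ht hi horth => ?_
  have htn : t.nat 0 0 0 = n := by rw [ht.nat (by decide), hn]
  have htf : HoldsFamily t f :=
    hf.congr (ht.nat (by decide)) (ht.nat (by decide)) (ht.real (by decide))
  have hcoef := run_project htn htf hi horth
  obtain ⟨hrow, hrest⟩ := run_subtract (s := project.run t) (f := f) (i := i)
    (by rw [run_nat (by decide), htn])
    (htf.congr (run_nat (by decide)) (run_nat (by decide)) (run_real (by decide)))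
    (by rw [run_nat (by decide), hi]) (by simp [hcoef])
  intro j hj k
  rw [State.real_setNat, run_seq]
  rcases (Nat.lt_succ_iff.1 hj).lt_or_eq with hj | hj
  · rw [hrest j hj.ne, run_real (by decide), horth j hj]
  · obtain rfl := Fin.ext hj
    rw [gramSchmidt_apply]
    simp only [hrow, hcoef, ite_mul, zero_mul, ← mem_Iio, Fintype.sum_ite_mem]
    refine congrArg (f j k - ·) (sum_congr rfl fun l hl => ?_)
    rw [run_real (by decide), horth l (Fin.lt_def.1 (mem_Iio.1 hl))]

theorem run_rank (hn : s.nat 0 0 0 = n) (hf : HoldsFamily s f) :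
    (rank.run s).nat rk 0 0 = finrank ℝ (span ℝ (Set.range f)) := by
  classical
  rw [← card_gramSchmidt_ne_zero f]
  exact run_count (s := orthogonalize.run s) (p := normSq row) {i | gramSchmidt ℝ f i ≠ 0}
    (by rw [run_nat (by decide), hn]) (by decide) fun t i ht hi => by
      have hden := run_normSq (s := t) (i := row) (gramSchmidt ℝ f i)
        (by rw [ht.nat (by decide), run_nat (by decide), hn]) (by decide) hi
        fun k => by rw [ht.real (by decide), run_orthogonalize hn hf]
      simp [hden, ← EuclideanSpace.real_norm_sq_eq]

end Code

end RealRAM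

namespace PartialMatrix

open Finset Module Submodule

theorem colRank_eq_finrank_span_snoc {n : ℕ} {M : PartialMatrix n} {C S : Finset (Fin n)} :
    M.colRank C S = finrank ℝ (span ℝ (Set.range (Fin.snoc
      (fun i => if i ∈ S then M.col C i else 0) (ones C) :
        Fin (n + 1) → EuclideanSpace ℝ (Fin (n + 1))))) := by
  rw [colRank, le_antisymm (span_le.2 ?_) (span_le.2 ?_)]
  · rintro _ (rfl | ⟨i, hi, rfl⟩)
    · exact subset_span ⟨Fin.last n, by simp⟩
    · exact subset_span ⟨i.castSucc, by simp [mem_coe.1 hi]⟩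
  · rintro _ ⟨i, rfl⟩
    induction i using Fin.lastCases with
    | last => simpa using subset_span (Set.mem_insert _ _)
    | cast i =>
      by_cases hi : i ∈ S
      · simpa [hi] using subset_span
          (Set.mem_insert_of_mem _ (Set.mem_image_of_mem (M.col C) (mem_coe.2 hi)))
      · simp [hi]

end PartialMatrix

namespace RealRAM

/-- The instance `(M, d)` is stored as in `Encodes`, with `0` in place of the unspecified entries,
and its matrix has a further row and a further column of ones that meet in an entry `0`. -/
structure EncodesBordered (s : State) {n : ℕ} (M : PartialMatrix n) (d : ℕ) : Prop where
  encodes : Encodes s M d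
  val (k i : Fin n) : s.real 0 k i = M.val k i
  right (k : Fin n) : s.real 0 k n = 1
  bottom (i : Fin n) : s.real 0 n i = 1
  corner : s.real 0 n n = 0

variable {n d : ℕ} {M : PartialMatrix n} {s t : State} {A C K S : Finset (Fin n)}
  {v : Fin n}

open Module Submodule Finset

theorem EncodesBordered.adj_iff (h : EncodesBordered s M d) (i j : Fin n) :
    1 ≤ s.nat 2 i j ↔ M.Adj i j := by
  rw [(h.encodes.2.2 i j).1, PartialMatrix.Adj]
  split_ifs with hij <;> simp [hij]

theorem EncodesBordered.frame {p : Code} (h : EncodesBordered s M d) (hf : p.Frame s t)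
    (hp : 0 ∉ p.natWrites ∧ 1 ∉ p.natWrites ∧ 2 ∉ p.natWrites ∧ 0 ∉ p.realWrites) :
    EncodesBordered t M d := by
  have hr : t.real 0 = s.real 0 := hf.real hp.2.2.2
  exact ⟨by simpa only [Encodes, hf.nat hp.1, hf.nat hp.2.1, hf.nat hp.2.2.1, hr] using h.encodes,
    by simpa only [hr] using h.val, by simpa only [hr] using h.right,
    by simpa only [hr] using h.bottom, by simpa only [hr] using h.corner⟩

namespace Code

/-- The rows in `C` and the columns in `S` of the bordered matrix are selected, together with the
border. -/
structure Selects (s : State) (C S : Finset (Fin n)) : Prop where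
  rows : HoldsSet s rows C
  cols : HoldsSet s cols S
  last_row : s.nat Code.rows 0 n = 1
  last_col : s.nat Code.cols 0 n = 1

theorem Selects.congr (h : Selects s C S) (hrows : t.nat Code.rows = s.nat Code.rows)
    (hcols : t.nat Code.cols = s.nat Code.cols) : Selects t C S :=
  ⟨h.rows.congr hrows, h.cols.congr hcols, by rw [hrows, h.last_row], by rw [hcols, h.last_col]⟩

theorem run_rank_eq_colRank (h : EncodesBordered s M d) (hs : Selects s C S) :
    (rank.run s).nat rk 0 0 = M.colRank C S := by
  obtain ⟨hC, hS, hrow, hcol⟩ := hs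
  rw [PartialMatrix.colRank_eq_finrank_span_snoc]
  refine run_rank h.encodes.1 fun i k => ?_
  induction i using Fin.lastCases with
  | last =>
    induction k using Fin.lastCases with
    | last => simp [hrow, hcol, h.corner, PartialMatrix.ones, PartialMatrix.bordered_last]
    | cast k =>
      simp [hcol, h.right, PartialMatrix.ones, PartialMatrix.bordered_castSucc, hC k]
  | cast i =>
    induction k using Fin.lastCases with
    | last =>
      by_cases hi : i ∈ S <;>
        simp [hrow, h.bottom, PartialMatrix.col, PartialMatrix.bordered_last, hS i, hi]
    | cast k =>
      by_cases hi : i ∈ S <;>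
        simp [h.val, PartialMatrix.col, PartialMatrix.bordered_castSucc, hS i, hC k, hi]

/-- Selects the border of the matrix. -/
def selectBorder : Code :=
  setN rows (.const 0) (var 0) (.const 1) ;; setN cols (.const 0) (var 0) (.const 1)

theorem run_selectBorder (hn : s.nat 0 0 0 = n) (hC : HoldsSet s rows C) (hS : HoldsSet s cols S) :
    Selects (selectBorder.run s) C S := by
  constructor
  · intro i
    simp [selectBorder, hn, i.isLt.ne, hC i]
  · intro i
    simp [selectBorder, hn, i.isLt.ne, hS i]
  · simp [selectBorder, hn]
  · simp [selectBorder, hn]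

/-- The variable that keeps a rank for a comparison. -/
abbrev oldRk : ℕ := 16

/-- The counter for the elements of a set. -/
abbrev elt : ℕ := 17

/-- The array of natural numbers for a clique. -/
abbrev clique : ℕ := 18

/-- The variable for a neighbour `u` of `v`. -/
abbrev varU : ℕ := 19

/-- The variable for the vertex `v` that is a candidate for deletion. -/
abbrev varV : ℕ := 20

/-- The test whether the entry `(i, j)` is specified. -/
abbrev adj (i j : NatExpr) : Cond :=
  .natLE (.const 1) (.cell 2 i j)

/-- Equality of natural numbers. -/
abbrev eq (e f : NatExpr) : Cond :=
  .conj (.natLE e f) (.natLE f e)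

/-- Stores the neighbours of `u` in the set `src` other than `v`. -/
def maskNbrs (dst src u v : ℕ) : Code :=
  mask dst elt (.conj (mem src (var elt)) (.conj (adj (var u) (var elt))
    (.neg (eq (var elt) (var v)))))

theorem run_maskNbrs {dst src vu vv : ℕ} {u : Fin n} (h : EncodesBordered s M d)
    (hK : HoldsSet s src K) (hu : s.nat vu 0 0 = u) (hv : s.nat vv 0 0 = v)
    (hdst : dst ∉ [0, 2, vu, vv, elt]) (hsrc : elt ∉ [src, vu, vv]) :
    HoldsSet ((maskNbrs dst src vu vv).run s) dst (M.nbrs K u v) := by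
  simp only [List.mem_cons, List.not_mem_nil, or_false, not_or] at hdst hsrc
  obtain ⟨h0, h2, hdu, hdv, hde⟩ := hdst
  refine run_mask _ h.encodes.1 hde fun t i ht hi hti => ?_
  have keep (a : ℕ) (had : a ≠ dst) (hae : a ≠ elt) : t.nat a = s.nat a :=
    ht.nat (by simp [mask, natWrites, had, hae])
  have hsrci : t.nat src 0 i = s.nat src 0 i := by
    rcases eq_or_ne src dst with rfl | hsd
    · exact hti
    · rw [keep src hsd (Ne.symm hsrc.1)]
  simp [PartialMatrix.nbrs, hi, hsrci, hK.mem_iff, keep 2 (Ne.symm h2) (by decide), h.adj_iff, hu,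
    hv, keep vu (Ne.symm hdu) (Ne.symm hsrc.2.1), keep vv (Ne.symm hdv) (Ne.symm hsrc.2.2),
    le_antisymm_iff]

/-- Computes the ranks of the selected columns before and after adding the column `v`. -/
def depTest : Code :=
  selectBorder ;; rank ;; letN oldRk (var rk) ;; setN cols (.const 0) (var varV) (.const 1) ;; rank

/-- The outcome of `depTest`. -/
abbrev isDep : Cond :=
  .natLE (var rk) (var oldRk)

theorem Selects.insert (h : Selects s C S) :
    Selects (s.setNat Code.cols 0 v 1) C (insert v S) := by
  refine ⟨h.rows.congr (by funext; simp), fun i => ?_, by simp [h.last_row], by simp [h.last_col]⟩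
  rcases eq_or_ne i v with rfl | hi
  · simp
  · simp [Fin.val_ne_of_ne hi, hi, h.cols i]

theorem run_depTest (h : EncodesBordered s M d) (hC : HoldsSet s rows C) (hS : HoldsSet s cols S)
    (hv : s.nat varV 0 0 = v) : isDep.Holds (depTest.run s) ↔ M.Dep C S v := by
  have hsel := run_selectBorder h.encodes.1 hC hS
  have hold := run_rank_eq_colRank (h.frame (frame_run selectBorder s) (by decide)) hsel
  set s₁ := (rank ;; letN oldRk (var rk)).run (selectBorder.run s) with hs₁
  have hrun : depTest.run s = rank.run (s₁.setNat cols 0 v 1) := by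
    simp +decide [depTest, hs₁, run_nat, hv]
  have hsel₁ : Selects (s₁.setNat cols 0 v 1) C (insert v S) :=
    (hsel.congr (run_nat (by decide)) (run_nat (by decide))).insert
  have henc₁ : EncodesBordered (s₁.setNat cols 0 v 1) M d := by
    have := h.frame (frame_run (selectBorder ;; rank ;; letN oldRk (var rk) ;;
      setN cols (.const 0) (var varV) (.const 1)) s) (by decide)
    simpa +decide [hs₁, run_nat, hv] using this
  have hnew := run_rank_eq_colRank henc₁ hsel₁
  rw [← PartialMatrix.colRank_insert_le_iff, ← hold, ← hnew]
  simp +decide [hrun, run_nat, hs₁]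

/-- Tests whether the column `v` depends on those of the neighbours of `u` in the clique, in the
rows for which `b` holds. -/
def depOn (b : Cond) : Code :=
  mask rows elt b ;; maskNbrs cols clique varU varV ;; depTest

theorem run_depOn {b : Cond} {u : Fin n} (h : EncodesBordered s M d) (hK : HoldsSet s clique K)
    (hu : s.nat varU 0 0 = u) (hv : s.nat varV 0 0 = v)
    (hb : ∀ t (i : Fin n), (mask rows elt b).Frame s t → t.nat elt 0 0 = i → (b.Holds t ↔ i ∈ C)) :
    isDep.Holds ((depOn b).run s) ↔ M.Dep C (M.nbrs K u v) v := by
  have keep {a : ℕ} (ha : a ≠ rows ∧ a ≠ elt) : ((mask rows elt b).run s).nat a = s.nat a :=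
    run_nat (by simp [mask, natWrites, ha])
  have h₁ : EncodesBordered ((mask rows elt b).run s) M d :=
    h.frame (frame_run _ _) (by simp [mask, natWrites, realWrites])
  have hrows : HoldsSet ((mask rows elt b).run s) rows C :=
    run_mask _ h.encodes.1 (by decide) fun t i ht hi _ => hb t i ht hi
  have hcols := run_maskNbrs (dst := cols) h₁ (hK.congr (keep (by decide)))
    (by rw [keep (a := varU) (by decide), hu]) (by rw [keep (a := varV) (by decide), hv])
    (by decide) (by decide)
  exact run_depTest (h₁.frame (frame_run (maskNbrs cols clique varU varV) _) (by decide))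
    (hrows.congr (run_nat (by decide))) hcols (by rw [run_nat (by decide), keep (by decide), hv])

theorem run_depOn_clique {u : Fin n} (h : EncodesBordered s M d) (hK : HoldsSet s clique K)
    (hu : s.nat varU 0 0 = u) (hv : s.nat varV 0 0 = v) :
    isDep.Holds ((depOn (mem clique (var elt))).run s) ↔ M.Dep K (M.nbrs K u v) v :=
  run_depOn h hK hu hv fun t i ht hi => by
    simp +decide [ht.nat, hi, hK.mem_iff]

theorem run_depOn_insert {u : Fin n} (h : EncodesBordered s M d) (hK : HoldsSet s clique K)
    (hu : s.nat varU 0 0 = u) (hv : s.nat varV 0 0 = v) :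
    isDep.Holds ((depOn (.neg (.conj (.neg (mem clique (var elt)))
      (.neg (eq (var elt) (var varU)))))).run s) ↔ M.Dep (insert u K) (M.nbrs K u v) v :=
  run_depOn h hK hu hv fun t i ht hi => by
    simp +decide [ht.nat, hi, hK.mem_iff, hu, ← le_antisymm_iff, imp_iff_not_or,
      or_comm]

end Code

end RealRAM

/-! ### The algorithm -/

namespace RealRAM

variable {n d : ℕ} {M : PartialMatrix n} {s t : State} {A K X : Finset (Fin n)} {v : Fin n}

open Finset

namespace Code

/-- The array of natural numbers for the set of the remaining rows. -/
abbrev alive : ℕ := 21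

/-- The array of natural numbers for the candidates for extending the clique. -/
abbrev cand : ℕ := 22

/-- The variable for the result of the search for the next point of the clique. -/
abbrev best : ℕ := 23

/-- A counter for candidates. -/
abbrev varB : ℕ := 24

/-- A counter for candidates. -/
abbrev varX : ℕ := 25

/-- A counter for candidates. -/
abbrev varY : ℕ := 26

/-- The variable for the degree of `varB`. -/
abbrev degB : ℕ := 27

/-- The variable for the degree of `varX`. -/
abbrev degX : ℕ := 28

/-- The variable for the result of the search for a candidate of larger degree than `varB`. -/
abbrev better : ℕ := 29

/-- The counter for the steps of the greedy construction. -/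
abbrev step : ℕ := 30

/-- Computes the number of candidates that are adjacent to the value of the variable `b`. -/
def degree (dst b : ℕ) : Code :=
  count dst 0 varY skip (.conj (mem cand (var varY)) (adj (var b) (var varY)))

theorem run_degree {dst b : ℕ} {x : Fin n} (h : EncodesBordered s M d) (hX : HoldsSet s cand X)
    (hb : s.nat b 0 0 = x) (hdst : dst ∉ [0, 2, cand, varY, b]) (hbY : b ≠ varY) :
    ((degree dst b).run s).nat dst 0 0 = #{y ∈ X | M.Adj x y} := by
  simp only [List.mem_cons, List.not_mem_nil, or_false, not_or] at hdst
  obtain ⟨h0, h2, hcand, hY, hdb⟩ := hdst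
  refine run_count (c := 0) {y ∈ X | M.Adj x y} h.encodes.1 (by simp [natWrites, h0, hY])
    fun t y ht hy => ?_
  have keep (a : ℕ) (ha : a ≠ dst) (haY : a ≠ varY) : t.nat a = s.nat a :=
    ht.nat (by simp [count, natWrites, ha, haY])
  simp [hy, keep cand (Ne.symm hcand) (by decide), keep 2 (Ne.symm h2) (by decide),
    keep b (Ne.symm hdb) hbY, hb, hX.mem_iff, h.adj_iff]

/-- Searches for a candidate `varX` whose degree exceeds `degB`. -/
def findBetter : Code :=
  find better varX (degree degX varX)
    (.conj (mem cand (var varX)) (.natLE (.add (var degB) (.const 1)) (var degX)))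

theorem run_findBetter {b : Fin n} (h : EncodesBordered s M d) (hX : HoldsSet s cand X)
    (hb : s.nat degB 0 0 = #{y ∈ X | M.Adj b y}) :
    (findBetter.run s).nat better 0 0 = 0 ↔
      ∀ x ∈ X, #{y ∈ X | M.Adj x y} ≤ #{y ∈ X | M.Adj b y} := by
  rw [findBetter, run_find_eq_zero
    (fun x => x ∈ X ∧ #{y ∈ X | M.Adj b y} + 1 ≤ #{y ∈ X | M.Adj x y})
    h.encodes.1 (by decide) (by decide) fun t x ht hx => ?_]
  · simp
  · have hXt : HoldsSet t cand X := hX.congr (ht.nat (by decide))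
    have hdeg := run_degree (dst := degX) (h.frame ht (by decide)) hXt hx (by decide) (by decide)
    simp +decide [hdeg, run_nat, hx, hX.mem_iff, ht.nat, hb]

/-- Searches for a candidate of maximal degree. -/
def pick : Code :=
  find best varB (degree degB varB ;; findBetter)
    (.conj (mem cand (var varB)) (.natLE (var better) (.const 0)))

theorem run_pick (h : EncodesBordered s M d) (hX : HoldsSet s cand X) :
    (pick.run s).nat best 0 0 = 0 ∧ X = ∅ ∨
      ∃ b ∈ X, (∀ x ∈ X, #{y ∈ X | M.Adj x y} ≤ #{y ∈ X | M.Adj b y}) ∧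
        (pick.run s).nat best 0 0 = b + 1 := by
  refine (run_find (fun b => b ∈ X ∧ ∀ x ∈ X, #{y ∈ X | M.Adj x y} ≤ #{y ∈ X | M.Adj b y})
    h.encodes.1 (by decide) (by decide) fun t b ht hb => ?_).imp
      (fun ⟨h0, hmax⟩ => ⟨h0, not_nonempty_iff_eq_empty.1 fun hne => ?_⟩)
      fun ⟨b, ⟨hb, hmax⟩, hbest⟩ => ⟨b, hb, hmax, hbest⟩
  · have ht' := h.frame ht (by decide)
    have hXt : HoldsSet t cand X := hX.congr (ht.nat (by decide))
    have hdeg := run_degree (dst := degB) ht' hXt hb (by decide) (by decide)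
    have hbetter := run_findBetter (ht'.frame (frame_run (degree degB varB) t) (by decide))
      (hXt.congr (run_nat (by decide))) hdeg
    simp +decide [hbetter, run_nat, hb, hXt.mem_iff]
  · obtain ⟨b, hb, hbX⟩ := exists_max_image X (fun x => #{y ∈ X | M.Adj x y}) hne
    exact hmax b ⟨hb, hbX⟩

/-- Moves a candidate of maximal degree to the clique, and keeps only its neighbours as
candidates. -/
def greedyStep : Code :=
  pick ;; ite (.natLE (.const 1) (var best))
    (letN varB (.sub (var best) (.const 1)) ;; setN clique (.const 0) (var varB) (.const 1) ;;
      maskNbrs cand cand varB varB) skip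

theorem run_greedyStep {i : ℕ} (h : EncodesBordered s M d) (hK : HoldsSet s clique K)
    (hX : HoldsSet s cand X) (hKX : M.IsGreedyClique A K X i) :
    ∃ K' X', HoldsSet (greedyStep.run s) clique K' ∧ HoldsSet (greedyStep.run s) cand X' ∧
      M.IsGreedyClique A K' X' (i + 1) := by
  have hK₁ : HoldsSet (pick.run s) clique K := hK.congr (run_nat (by decide))
  have hX₁ : HoldsSet (pick.run s) cand X := hX.congr (run_nat (by decide))
  rcases run_pick h hX with ⟨h0, rfl⟩ | ⟨b, hb, hmax, hbest⟩
  · exact ⟨K, ∅, by simpa [greedyStep, h0] using hK₁, by simpa [greedyStep, h0] using hX₁,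
      hKX.succ_of_empty⟩
  set s₂ := ((pick.run s).setNat varB 0 0 b).setNat clique 0 b 1 with hs₂
  have hrun : greedyStep.run s = (maskNbrs cand cand varB varB).run s₂ := by
    simp [greedyStep, hbest, hs₂]
  have hK₂ : HoldsSet s₂ clique (insert b K) := fun j => by
    rcases eq_or_ne j b with rfl | hj
    · simp [hs₂]
    · simp +decide [hs₂, Fin.val_ne_of_ne hj, hj, hK₁ j]
  have henc₂ : EncodesBordered s₂ M d := by
    simpa [hs₂, hbest] using h.frame (frame_run (pick ;; letN varB (.sub (var best) (.const 1)) ;;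
      setN clique (.const 0) (var varB) (.const 1)) s) (by decide)
  have hX₂ : HoldsSet s₂ cand X := hX₁.congr (by funext; simp [hs₂])
  have hb₂ : s₂.nat varB 0 0 = b := by simp [hs₂]
  refine ⟨insert b K, M.nbrs X b b, ?_, ?_, hKX.succ hb hmax⟩
  · rw [hrun]
    exact hK₂.congr (run_nat (by decide))
  · rw [hrun]
    exact run_maskNbrs henc₂ hX₂ hb₂ hb₂ (by decide) (by decide)

/-- Starts with the empty clique, for which all remaining rows are candidates. -/
def initGreedy : Code :=
  mask clique elt (.neg (.natLE (.const 0) (.const 0))) ;; mask cand elt (mem alive (var elt))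

theorem run_initGreedy (hn : s.nat 0 0 0 = n) (hA : HoldsSet s alive A) :
    HoldsSet (initGreedy.run s) clique (∅ : Finset (Fin n)) ∧
      HoldsSet (initGreedy.run s) cand A := by
  set s₁ := (mask clique elt (.neg (.natLE (.const 0) (.const 0)))).run s with hs₁
  have hclique : HoldsSet s₁ clique (∅ : Finset (Fin n)) :=
    run_mask ∅ hn (by decide) fun t i _ _ _ => by simp
  have hn₁ : s₁.nat 0 0 0 = n := by rw [hs₁, run_nat (by decide), hn]
  rw [initGreedy, run_seq, ← hs₁]
  refine ⟨hclique.congr (run_nat (by decide)), run_mask A hn₁ (by decide) fun t i ht hi _ => ?_⟩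
  simp +decide [ht.nat, hi, hs₁, run_nat, hA.mem_iff]

/-- The greedy construction of a clique of remaining rows. -/
def greedy : Code :=
  initGreedy ;; forN 0 step greedyStep

theorem run_greedy (h : EncodesBordered s M d) (hA : HoldsSet s alive A) :
    ∃ K, HoldsSet (greedy.run s) clique K ∧ M.IsLargeClique A K := by
  obtain ⟨hclique, hcand⟩ := run_initGreedy h.encodes.1 hA
  obtain ⟨K, X, hK, -, hKX⟩ : ∃ K X, HoldsSet (greedy.run s) clique K ∧
      HoldsSet (greedy.run s) cand X ∧ M.IsGreedyClique A K X n := by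
    refine seq_forN_induction (c := 0) (fun i t => ∃ K X, HoldsSet t clique K ∧ HoldsSet t cand X ∧
      M.IsGreedyClique A K X i) h.encodes.1 (by decide) ?_ fun i t ht _ ⟨K, X, hK, hX, hKX⟩ => ?_
    · exact ⟨∅, A, hclique.congr (State.nat_setNat_of_ne _ (by decide) ..),
        hcand.congr (State.nat_setNat_of_ne _ (by decide) ..), .zero⟩
    · obtain ⟨K', X', hK', hX', hKX'⟩ := run_greedyStep (h.frame ht (by decide)) hK hX hKX
      exact ⟨K', X', hK'.congr (State.nat_setNat_of_ne _ (by decide) ..),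
        hX'.congr (State.nat_setNat_of_ne _ (by decide) ..), hKX'⟩
  exact ⟨K, hK, hKX.isLargeClique⟩

end Code

end RealRAM

namespace RealRAM

variable {n d : ℕ} {M : PartialMatrix n} {s t : State} {A K : Finset (Fin n)} {v : Fin n}

open Finset

namespace Code

/-- The variable for the result of the search for a neighbour of `varV` whose row refutes a
dependency. -/
abbrev bad : ℕ := 31

/-- The variable for the result of the search for a point that can be deleted. -/
abbrev removable : ℕ := 32

/-- The variable that is set to `1` when the instance turns out to be a no-instance. -/
abbrev no : ℕ := 33

/-- Searches for a remaining neighbour `varU` of `varV` for which the test of `depOn b` fails. -/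
def findBad (b : Cond) : Code :=
  find bad varU (depOn b)
    (.conj (mem alive (var varU)) (.conj (adj (var varU) (var varV)) (.neg isDep)))

theorem run_findBad {b : Cond} (P : Fin n → Prop) (h : EncodesBordered s M d)
    (hA : HoldsSet s alive A) (hv : s.nat varV 0 0 = v)
    (hP : ∀ t (u : Fin n), (findBad b).Frame s t → t.nat varU 0 0 = u →
      (isDep.Holds ((depOn b).run t) ↔ P u)) :
    ((findBad b).run s).nat bad 0 0 = 0 ↔ ∀ u ∈ A, M.Adj u v → P u := by
  rw [findBad, run_find_eq_zero (fun u => u ∈ A ∧ M.Adj u v ∧ ¬ P u) h.encodes.1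
    (of_decide_eq_true rfl) (of_decide_eq_true rfl) fun t u ht hu => ?_]
  · simp
  · have hA' : HoldsSet ((depOn b).run t) alive A :=
      (hA.congr (ht.nat (of_decide_eq_true rfl))).congr (run_nat (of_decide_eq_true rfl))
    have h' := (h.frame ht (of_decide_eq_true rfl)).frame (frame_run (depOn b) t)
      (of_decide_eq_true rfl)
    have hu' : ((depOn b).run t).nat varU 0 0 = u := by rw [run_nat (of_decide_eq_true rfl), hu]
    have hv' : ((depOn b).run t).nat varV 0 0 = v := by
      rw [run_nat (of_decide_eq_true rfl), ht.nat (of_decide_eq_true rfl), hv]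
    rw [← hP t u ht hu]
    simp [hu', hv', hA'.mem_iff, h'.adj_iff]

/-- Searches for a point `varV` of the clique such that, in the rows in the clique, its column
depends on those of the other common neighbours of any remaining neighbour. -/
def findRemovable : Code :=
  find removable varV (findBad (mem clique (var elt)))
    (.conj (mem clique (var varV)) (.natLE (var bad) (.const 0)))

theorem run_findRemovable (h : EncodesBordered s M d) (hA : HoldsSet s alive A)
    (hK : HoldsSet s clique K) :
    (findRemovable.run s).nat removable 0 0 = 0 ∧
        (∀ v ∈ K, ∃ u, M.Adj u v ∧ ¬ M.Dep K (M.nbrs K u v) v) ∨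
      ∃ v ∈ K, (∀ u ∈ A, M.Adj u v → M.Dep K (M.nbrs K u v) v) ∧
        (findRemovable.run s).nat removable 0 0 = v + 1 := by
  refine (run_find (fun v => v ∈ K ∧ ∀ u ∈ A, M.Adj u v → M.Dep K (M.nbrs K u v) v)
    h.encodes.1 (by decide) (by decide) fun t v ht hv => ?_).imp
      (fun ⟨h0, hnot⟩ => ⟨h0, fun v hv => ?_⟩) fun ⟨v, ⟨hv, hdep⟩, hr⟩ => ⟨v, hv, hdep, hr⟩
  · have hbad := run_findBad (b := mem clique (var elt))
      (fun u => M.Dep K (M.nbrs K u v) v) (h.frame ht (by decide))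
      (hA.congr (ht.nat (by decide))) hv fun t' u ht' hu =>
        run_depOn_clique ((h.frame ht (by decide)).frame ht' (by decide))
          (hK.congr ((ht'.nat (by decide)).trans (ht.nat (by decide)))) hu
          (by rw [ht'.nat (by decide), hv])
    simp +decide [hbad, run_nat, hv, ht.nat, hK.mem_iff]
  · have := hnot v
    push Not at this
    obtain ⟨u, -, hu⟩ := this hv
    exact ⟨u, hu⟩

/-- Computes the rank of the columns of the clique. -/
def cliqueRank : Code :=
  mask rows elt (mem clique (var elt)) ;; mask cols elt (mem clique (var elt)) ;;
    selectBorder ;; rank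

theorem run_cliqueRank (h : EncodesBordered s M d) (hK : HoldsSet s clique K) :
    (cliqueRank.run s).nat rk 0 0 = M.colRank K K := by
  set s₁ := (mask rows elt (mem clique (var elt))).run s
  set s₂ := (mask cols elt (mem clique (var elt))).run s₁
  have h₁ : EncodesBordered s₁ M d := h.frame (frame_run _ s) (by decide)
  have h₂ : EncodesBordered s₂ M d := h₁.frame (frame_run _ s₁) (by decide)
  have hK₁ : HoldsSet s₁ clique K := hK.congr (run_nat (by decide))
  have hrows : HoldsSet s₁ rows K := run_mask K h.encodes.1 (by decide) fun t i ht hi _ => by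
    simp +decide [ht.nat, hi, hK.mem_iff]
  have hcols : HoldsSet s₂ cols K := run_mask K h₁.encodes.1 (by decide) fun t i ht hi _ => by
    simp +decide [ht.nat, hi, hK₁.mem_iff]
  exact run_rank_eq_colRank (h₂.frame (frame_run selectBorder s₂) (by decide))
    (run_selectBorder h₂.encodes.1 (hrows.congr (run_nat (by decide))) hcols)

end Code

end RealRAM

namespace RealRAM

variable {n d : ℕ} {M : PartialMatrix n} {s t : State} {A K : Finset (Fin n)} {v : Fin n}

open Finset

namespace Code

/-- The instance on the remaining rows `A` is equivalent to `(M, d)`, and if the variable `no` has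
been set, then these are no-instances. -/
structure Reduces (s : State) (M : PartialMatrix n) (d : ℕ) (A : Finset (Fin n)) : Prop where
  alive : HoldsSet s Code.alive A
  nonempty : n ≠ 0 → A.Nonempty
  realizable : M.RealizableOn d A → M.RealizableOn d univ
  no : s.nat Code.no 0 0 ≠ 0 → ¬ M.RealizableOn d A

theorem Reduces.congr (h : Reduces s M d A) (ha : t.nat Code.alive = s.nat Code.alive)
    (hn : t.nat Code.no = s.nat Code.no) : Reduces t M d A :=
  ⟨h.alive.congr ha, h.nonempty, h.realizable, by simpa only [hn] using h.no⟩

theorem Reduces.setNo (h : Reduces s M d A) (hno : ¬ M.RealizableOn d A) :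
    Reduces ((letN Code.no (.const 1)).run s) M d A :=
  ⟨h.alive.congr (run_nat (by decide)), h.nonempty, h.realizable, fun _ => hno⟩

theorem Reduces.erase (h : Reduces s M d A) (hA : (A.erase v).Nonempty)
    (hv : M.RealizableOn d (A.erase v) → M.RealizableOn d A) :
    Reduces (s.setNat Code.alive 0 v 0) M d (A.erase v) where
  alive i := by
    rcases eq_or_ne i v with rfl | hi
    · simp
    · simp [Fin.val_ne_of_ne hi, hi, h.alive i]
  nonempty _ := hA
  realizable := h.realizable ∘ hv
  no hno := mt hv (h.no (by simpa +decide using hno))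

/-- The test of `depOn` in the rows in the clique and the row `varU`. -/
abbrev inInsert : Cond :=
  .neg (.conj (.neg (mem clique (var elt))) (.neg (eq (var elt) (var varU))))

/-- Deletes the row found by `findRemovable` unless this exhibits a no-instance. -/
def erase : Code :=
  letN varV (.sub (var removable) (.const 1)) ;; findBad inInsert ;;
    ite (.natLE (var bad) (.const 0)) (setN alive (.const 0) (var varV) (.const 0))
      (letN no (.const 1))

theorem run_erase (h : EncodesBordered s M d) (hA : Reduces s M d A) (hK : HoldsSet s clique K)
    (hKA : M.IsLargeClique A K) (hr : s.nat removable 0 0 = v + 1) (hv : v ∈ K)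
    (hdep : ∀ u ∈ A, M.Adj u v → M.Dep K (M.nbrs K u v) v) :
    (erase.run s).nat no 0 0 ≠ 0 ∧ Reduces (erase.run s) M d A ∨
      (erase.run s).nat no 0 0 = s.nat no 0 0 ∧ Reduces (erase.run s) M d (A.erase v) := by
  set s₁ := s.setNat varV 0 0 v with hs₁
  set s₂ := (findBad inInsert).run s₁ with hs₂
  have hrun : erase.run s = (ite (.natLE (var bad) (.const 0))
      (setN alive (.const 0) (var varV) (.const 0)) (letN no (.const 1))).run s₂ := by
    simp [erase, hr, hs₁, hs₂]
  have h₁ : EncodesBordered s₁ M d := by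
    simpa [hs₁, hr] using h.frame (frame_run (letN varV (.sub (var removable) (.const 1))) s)
      (by decide)
  have hA₁ : Reduces s₁ M d A :=
    hA.congr (s.nat_setNat_of_ne (by decide) ..) (s.nat_setNat_of_ne (by decide) ..)
  have hK₁ : HoldsSet s₁ clique K := hK.congr (s.nat_setNat_of_ne (by decide) ..)
  have hv₁ : s₁.nat varV 0 0 = v := by simp [hs₁]
  have hbad : s₂.nat bad 0 0 = 0 ↔ M.Redundant A K v := by
    refine run_findBad _ h₁ hA₁.alive hv₁ fun t u ht hu => run_depOn_insert
      (h₁.frame ht (by decide)) (hK₁.congr (ht.nat (by decide))) hu ?_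
    rw [ht.nat (by decide), hv₁]
  have hA₂ : Reduces s₂ M d A := hA₁.congr (run_nat (by decide)) (run_nat (by decide))
  have hv₂ : s₂.nat varV 0 0 = v := by rw [hs₂, run_nat (by decide), hv₁]
  have hno₂ : s₂.nat no 0 0 = s.nat no 0 0 := by
    rw [hs₂, run_nat (by decide), hs₁, s.nat_setNat_of_ne (by decide)]
  rw [hrun]
  by_cases hred : M.Redundant A K v
  · refine .inr ⟨by simp [hbad.2 hred, hno₂], ?_⟩
    simpa [hbad.2 hred, hv₂] using
      hA₂.erase (hred.erase_nonempty hKA.subset hv) (.of_erase hKA.subset hKA.adj hv hred)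
  · have hno : ¬ M.RealizableOn d A := fun hreal => hred fun u hu huv =>
      hreal.dep_insert hKA.subset hKA.adj hu hv huv (filter_subset ..)
        (fun w hw => (mem_filter.1 hw).2.1) (hdep u hu huv)
    exact .inl ⟨by simp [mt hbad.1 hred], by simpa [mt hbad.1 hred] using hA₂.setNo hno⟩

/-- Deletes a row, establishes that the remaining rows are few enough, or exhibits a
no-instance. -/
def round : Code :=
  greedy ;; cliqueRank ;; ite (.natLE (var rk) (.add (var 1) (.const 2)))
    (findRemovable ;; ite (.natLE (var removable) (.const 0)) skip erase) (letN no (.const 1))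

theorem run_round (hd : d ≠ 0) (h : EncodesBordered s M d) (hA : Reduces s M d A) :
    ∃ B, Reduces (round.run s) M d B ∧ #B ≤ #A ∧ ((round.run s).nat no 0 0 ≠ 0 ∨
      (round.run s).nat no 0 0 = s.nat no 0 0 ∧ (M.Bounded d #B ∨ #B < #A)) := by
  obtain ⟨K, hK, hKA⟩ := run_greedy h hA.alive
  set s₁ := greedy.run s with hs₁
  set s₂ := cliqueRank.run s₁ with hs₂
  set s₃ := findRemovable.run s₂ with hs₃
  have h₁ : EncodesBordered s₁ M d := h.frame (frame_run greedy s) (by decide)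
  have h₂ : EncodesBordered s₂ M d := h₁.frame (frame_run cliqueRank s₁) (by decide)
  have h₃ : EncodesBordered s₃ M d := h₂.frame (frame_run findRemovable s₂) (by decide)
  have hA₁ : Reduces s₁ M d A := hA.congr (run_nat (by decide)) (run_nat (by decide))
  have hA₂ : Reduces s₂ M d A := hA₁.congr (run_nat (by decide)) (run_nat (by decide))
  have hA₃ : Reduces s₃ M d A := hA₂.congr (run_nat (by decide)) (run_nat (by decide))
  have hK₂ : HoldsSet s₂ clique K := hK.congr (run_nat (by decide))
  have hno₃ : s₃.nat no 0 0 = s.nat no 0 0 := by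
    rw [hs₃, run_nat (by decide), hs₂, run_nat (by decide), hs₁, run_nat (by decide)]
  have hrk : s₂.nat rk 0 0 = M.colRank K K := run_cliqueRank h₁ hK
  have hd₂ : s₂.nat 1 0 0 = d := h₂.encodes.2.1
  by_cases hrank : M.colRank K K ≤ d + 2
  · have hrun : round.run s = (ite (.natLE (var removable) (.const 0)) skip erase).run s₃ := by
      simp [round, ← hs₁, ← hs₂, hrk, hd₂, hrank, hs₃]
    rw [hrun]
    rcases run_findRemovable h₂ hA₂.alive hK₂ with ⟨h0, hdep⟩ | ⟨v, hv, hdep, hr⟩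
    · rw [run_ite, if_pos (by simp [hs₃, h0]), run_skip]
      exact ⟨A, hA₃, le_rfl, .inr ⟨hno₃, .inl (hKA.bounded hd hrank hdep)⟩⟩
    · rw [run_ite, if_neg (by simp [hs₃, hr]), ← hno₃]
      rcases run_erase h₃ hA₃ (hK₂.congr (run_nat (by decide))) hKA hr hv hdep with
        ⟨hno, hA'⟩ | ⟨hno, hA'⟩
      · exact ⟨A, hA', le_rfl, .inl hno⟩
      · have hlt := card_erase_lt_of_mem (hKA.subset hv)
        exact ⟨A.erase v, hA', hlt.le, .inr ⟨hno, .inr hlt⟩⟩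
  · have hrun : round.run s = (letN no (.const 1)).run s₂ := by
      simp [round, ← hs₁, ← hs₂, hrk, hd₂, hrank]
    have hno : ¬ M.RealizableOn d A := mt (fun hA => hA.colRank_le hKA.subset hKA.adj) hrank
    exact ⟨A, hrun ▸ hA₂.setNo hno, le_rfl, .inl (by simp [hrun])⟩

end Code

end RealRAM

theorem card_filter_lt_orderEmbOfFin {α : Type*} [LinearOrder α] (s : Finset α)
    (k : Fin s.card) : {a ∈ s | a < s.orderEmbOfFin rfl k}.card = k := by
  have : {a ∈ s | a < s.orderEmbOfFin rfl k} =
      (Finset.Iio k).map (s.orderEmbOfFin rfl).toEmbedding := by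
    ext a
    simp only [Finset.mem_filter, Finset.mem_map, Finset.mem_Iio, RelEmbedding.coe_toEmbedding]
    constructor
    · rintro ⟨ha, hlt⟩
      obtain ⟨l, rfl⟩ := (s.range_orderEmbOfFin rfl).symm.subset ha
      exact ⟨l, (s.orderEmbOfFin rfl).lt_iff_lt.1 hlt, rfl⟩
    · rintro ⟨l, hl, rfl⟩
      exact ⟨s.orderEmbOfFin_mem rfl l, (s.orderEmbOfFin rfl).lt_iff_lt.2 hl⟩
  rw [this, Finset.card_map, Fin.card_Iio]

namespace RealRAM

variable {n d : ℕ} {M : PartialMatrix n} {s t : State} {A : Finset (Fin n)}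

open Finset

theorem encodes_input (M : PartialMatrix n) (d : ℕ) : Encodes (input M d) M d := by
  refine ⟨by simp [input], by simp [input], fun i j => ⟨by simp [input], fun x hx => ?_⟩⟩
  simp [input, hx]

namespace Code

/-- Adds a further row and a further column of ones to the matrix. -/
def border : Code :=
  forN 0 elt (setR 0 (var elt) (var 0) (.ofNat (.const 1)) ;;
    setR 0 (var 0) (var elt) (.ofNat (.const 1)))

theorem encodesBordered_border (M : PartialMatrix n) (d : ℕ) :
    EncodesBordered (border.run (input M d)) M d := by
  have h := encodes_input M d
  obtain ⟨hreal, hborder⟩ : (∀ i j, (i < n ↔ j < n) →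
      (border.run (input M d)).real 0 i j = (input M d).real 0 i j) ∧
      ∀ i : Fin n, i < n + 0 → (border.run (input M d)).real 0 i n = 1 ∧
        (border.run (input M d)).real 0 n i = 1 := by
    refine forN_induction (c := 0) (fun m t => (∀ i j, (i < n ↔ j < n) →
      t.real 0 i j = (input M d).real 0 i j) ∧
      ∀ i : Fin n, i < m → t.real 0 i n = 1 ∧ t.real 0 n i = 1) h.1 (by simp)
      fun (i : Fin n) t ht hi ⟨hreal, hborder⟩ => ?_
    have hn : t.nat 0 0 0 = n := by rw [ht.nat (by decide), h.1]
    refine ⟨fun k l hkl => ?_, fun k hk => ?_⟩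
    · have hright : ¬ (k = i ∧ l = n) := by rintro ⟨rfl, rfl⟩; simp at hkl
      have hbottom : ¬ (k = n ∧ l = i) := by rintro ⟨rfl, rfl⟩; simp at hkl
      simp [hi, hn, hright, hbottom, hreal k l hkl]
    · rcases (Nat.lt_succ_iff.1 hk).lt_or_eq with hk | hk
      · simp [hi, hn, hborder k hk, k.2.ne, hk.ne]
      · simp [hi, hn, hk]
  have hnat {a : ℕ} (ha : a ∉ border.natWrites) := run_nat (s := input M d) ha
  exact
    { encodes := by
        refine ⟨by rw [hnat (by decide), h.1], by rw [hnat (by decide), h.2.1], fun i j => ?_⟩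
        rw [hnat (by decide), hreal i j (by simp)]
        exact h.2.2 i j
      val := fun i j => (hreal i j (by simp)).trans (by simp [input, PartialMatrix.val])
      right := fun i => (hborder i i.2).1
      bottom := fun i => (hborder i i.2).2
      corner := (hreal n n .rfl).trans (by simp [input]) }

/-- Borders the matrix and lets all rows remain. -/
def setup : Code :=
  border ;; letN no (.const 0) ;; mask alive elt (.natLE (.const 0) (.const 0))

theorem encodesBordered_setup (M : PartialMatrix n) (d : ℕ) :
    EncodesBordered (setup.run (input M d)) M d :=
  (encodesBordered_border M d).frame (frame_run (letN no (.const 0) ;;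
    mask alive elt (.natLE (.const 0) (.const 0))) _) (by decide)

theorem reduces_setup (M : PartialMatrix n) (d : ℕ) :
    Reduces (setup.run (input M d)) M d univ where
  alive := run_mask univ ((encodesBordered_border M d).frame (frame_run (letN no (.const 0)) _)
    (by decide)).encodes.1 (by decide) fun t i _ _ _ => by simp
  nonempty hn := have : NeZero n := ⟨hn⟩; univ_nonempty
  realizable := id
  no := by simp +decide [setup, run_nat]

/-- The variable for the number of remaining rows. -/
abbrev size : ℕ := 34

/-- The array of natural numbers for the increasing list of the remaining rows. -/
abbrev list : ℕ := 35

/-- Lists the remaining rows. -/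
def enumerate : Code :=
  letN size (.const 0) ;; forN 0 elt (ite (mem alive (var elt))
    (setN list (.const 0) (var size) (var elt) ;; letN size (.add (var size) (.const 1))) skip)

theorem run_enumerate (hn : s.nat 0 0 0 = n) (hA : HoldsSet s alive A) :
    (enumerate.run s).nat size 0 0 = #A ∧
      ∀ k : Fin #A, (enumerate.run s).nat list 0 k = A.orderEmbOfFin rfl k := by
  set f := A.orderEmbOfFin rfl
  suffices (enumerate.run s).nat size 0 0 = #{a ∈ A | a.val < n + 0} ∧
      ∀ k : Fin #A, (f k).val < n + 0 → (enumerate.run s).nat list 0 k = f k by simpa using this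
  refine seq_forN_induction (fun i t => t.nat size 0 0 = #{a ∈ A | a.val < i} ∧
    ∀ k : Fin #A, (f k).val < i → t.nat list 0 k = f k) hn (by decide) (by simp)
    fun (i : Fin n) t ht hi ⟨hsize, hlist⟩ => ?_
  have hAt : HoldsSet t alive A := hA.congr (ht.nat (by decide))
  have hlt (a : Fin n) : a.val < i.val + 1 ↔ a = i ∨ a.val < i := by
    rw [Nat.lt_succ_iff_lt_or_eq, Fin.ext_iff, or_comm]
  simp only [hlt, filter_or]
  by_cases hiA : i ∈ A
  · obtain ⟨k₀, hk₀ : f k₀ = i⟩ := (A.range_orderEmbOfFin rfl).symm.subset hiA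
    have hk₀size : t.nat size 0 0 = k₀ := by
      rw [hsize, ← card_filter_lt_orderEmbOfFin A k₀, ← hk₀]
      rfl
    refine ⟨?_, fun k hk => ?_⟩
    · rw [card_union_of_disjoint (disjoint_filter.2 fun a _ h => by simp [h]), filter_eq' A i]
      simp [hi, hAt.mem_iff, hiA, hsize, add_comm]
    · rcases eq_or_ne k k₀ with rfl | hkk₀
      · simp [hi, hAt.mem_iff, hiA, hk₀size, hk₀]
      · have hki : f k ≠ i := hk₀ ▸ f.injective.ne hkk₀
        simp [hi, hAt.mem_iff, hiA, hk₀size, Fin.val_ne_of_ne hkk₀, hlist k (hk.resolve_left hki)]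
  · refine ⟨?_, fun k hk => ?_⟩
    · simp [hi, hAt.mem_iff, hiA, hsize, filter_eq' A i]
    · have hki : f k ≠ i := ne_of_mem_of_not_mem (A.orderEmbOfFin_mem rfl k) hiA
      simp [hi, hAt.mem_iff, hiA, hlist k (hk.resolve_left hki)]

end Code

end RealRAM

theorem val_le_val_orderEmbOfFin {n : ℕ} (s : Finset (Fin n)) (k : Fin s.card) :
    k.val ≤ (s.orderEmbOfFin rfl k).val := by
  rw [← card_filter_lt_orderEmbOfFin s k, ← Fin.card_Iio]
  exact Finset.card_le_card fun a ha => Finset.mem_Iio.2 (Finset.mem_filter.1 ha).2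

namespace RealRAM

variable {n d m : ℕ} {M : PartialMatrix n} {s t : State} {A : Finset (Fin n)} {f : Fin m → ℕ}

open Finset

/-- The contents of the two cells that store entry `(i, j)` of the matrix. -/
def State.entry (s : State) (i j : ℕ) : ℕ × ℝ :=
  (s.nat 2 i j, s.real 0 i j)

namespace Code

/-- The row of the entry to be written. -/
abbrev varI : ℕ := 36

/-- The column of the entry to be written. -/
abbrev varJ : ℕ := 37

/-- Replaces an entry by the one in the row and the column listed in its place. -/
def moveEntry : Code :=
  setN 2 (var varI) (var varJ) (.cell 2 (.cell list (.const 0) (var varI))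
      (.cell list (.const 0) (var varJ))) ;;
    setR 0 (var varI) (var varJ) (.cell 0 (.cell list (.const 0) (var varI))
      (.cell list (.const 0) (var varJ)))

theorem entry_run_moveEntry (s : State) (k l : ℕ) :
    (moveEntry.run s).entry k l = if k = s.nat varI 0 0 ∧ l = s.nat varJ 0 0 then
      s.entry (s.nat list 0 (s.nat varI 0 0)) (s.nat list 0 (s.nat varJ 0 0))
    else s.entry k l := by
  split_ifs with h <;> simp [moveEntry, State.entry, h]

/-- Moves to row `varI` the entries in the row and the columns listed. -/
def moveRow : Code :=
  forN 0 varJ moveEntry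

theorem run_moveRow (hn : s.nat 0 0 0 = n) (hm : m ≤ n) (hf : ∀ k, k ≤ f k)
    (hlist : ∀ k : Fin m, s.nat list 0 k = f k) :
    (∀ k l, k ≠ s.nat varI 0 0 → (moveRow.run s).entry k l = s.entry k l) ∧
      ∀ k l : Fin m, k = s.nat varI 0 0 → (moveRow.run s).entry k l = s.entry (f k) (f l) := by
  set i := s.nat varI 0 0
  suffices (∀ k l, k ≠ i ∨ n + 0 ≤ l → (moveRow.run s).entry k l = s.entry k l) ∧
      ∀ k l : Fin m, k = i → l < n + 0 → (moveRow.run s).entry k l = s.entry (f k) (f l) from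
    ⟨fun k l hk => this.1 k l (.inl hk), fun k l hk => this.2 k l hk (l.2.trans_le hm)⟩
  refine forN_induction (fun j t => (∀ k l, k ≠ i ∨ j ≤ l → t.entry k l = s.entry k l) ∧
    ∀ k l : Fin m, k = i → l < j → t.entry k l = s.entry (f k) (f l)) hn (by simp [State.entry])
    fun j t ht hj ⟨hkeep, hmove⟩ => ?_
  have hi : t.nat varI 0 0 = i := by rw [ht.nat (by decide)]
  have hentry (k l : ℕ) : ((moveEntry.run t).setNat varJ 0 0 (j + 1)).entry k l =
      if k = i ∧ l = j then t.entry (s.nat list 0 i) (s.nat list 0 j) else t.entry k l := by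
    rw [← ht.nat (a := list) (by decide), ← hi, ← hj, ← entry_run_moveEntry]
    simp [State.entry]
  refine ⟨fun k l hkl => ?_, fun k l hk hl => ?_⟩
  · rw [hentry, if_neg (by omega), hkeep k l (by omega)]
  · rw [hentry]
    split_ifs with h
    · rw [← h.1, ← h.2, hlist, hlist, hkeep _ _ (.inr (h.2 ▸ hf l))]
    · exact hmove k l hk (by omega)

/-- Moves the entries in the listed rows and columns to the upper left corner of the matrix. This
may be done in place, since a list of rows in increasing order has no row before its place. -/
def moveRows : Code :=
  forN 0 varI moveRow

theorem run_moveRows (hn : s.nat 0 0 0 = n) (hm : m ≤ n) (hf : ∀ k, k ≤ f k)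
    (hlist : ∀ k : Fin m, s.nat list 0 k = f k) (k l : Fin m) :
    (moveRows.run s).entry k l = s.entry (f k) (f l) := by
  suffices (∀ k l, n + 0 ≤ k → (moveRows.run s).entry k l = s.entry k l) ∧
      ∀ k l : Fin m, k < n + 0 → (moveRows.run s).entry k l = s.entry (f k) (f l) from
    this.2 k l (k.2.trans_le hm)
  refine forN_induction (fun i t => (∀ k l, i ≤ k → t.entry k l = s.entry k l) ∧
    ∀ k l : Fin m, k < i → t.entry k l = s.entry (f k) (f l)) hn (by simp [State.entry])
    fun i t ht hi ⟨hkeep, hmove⟩ => ?_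
  obtain ⟨hother, hrow⟩ := run_moveRow (s := t) (by rw [ht.nat (by decide), hn]) hm hf
    fun k => by rw [ht.nat (by decide), hlist]
  rw [hi] at hother hrow
  have hentry (k l : ℕ) : ((moveRow.run t).setNat varI 0 0 (i + 1)).entry k l =
      (moveRow.run t).entry k l := by simp [State.entry]
  simp only [hentry]
  refine ⟨fun k l hk => ?_, fun k l hk => ?_⟩
  · rw [hother k l (by omega), hkeep k l (by omega)]
  · rcases (Nat.lt_succ_iff.1 hk).lt_or_eq with hk | hk
    · rw [hother k l hk.ne, hmove k l hk]
    · rw [hrow k l hk, hkeep _ _ (hk ▸ hf k)]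

/-- Moves the instance on the remaining rows to the upper left corner of the matrix. -/
def compact : Code :=
  enumerate ;; moveRows ;; letN 0 (var size)

theorem run_compact (h : EncodesBordered s M d) (hA : HoldsSet s alive A) :
    Encodes (compact.run s) (M.principal (A.orderEmbOfFin rfl)) d := by
  obtain ⟨hsize, hlist⟩ := run_enumerate h.encodes.1 hA
  have henum : Encodes (enumerate.run s) M d := (h.frame (frame_run _ s) (by decide)).encodes
  have hentry := run_moveRows henum.1 (by simpa using card_le_univ A)
    (val_le_val_orderEmbOfFin A) hlist
  simp only [State.entry, Prod.mk.injEq] at hentry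
  have hrun : compact.run s = (moveRows.run (enumerate.run s)).setNat 0 0 0 #A := by
    simp [compact, run_nat (p := moveRows) (a := size) (by decide), hsize]
  rw [hrun]
  refine ⟨by simp, by simp [run_nat (p := moveRows) (a := 1) (by decide), henum.2.1], ?_⟩
  intro k l
  rw [State.nat_setNat_of_ne _ (by decide), State.real_setNat, (hentry k l).1, (hentry k l).2]
  exact henum.2.2 _ _

end Code

end RealRAM

namespace RealRAM

variable {n d : ℕ} {M : PartialMatrix n} {s : State} {A : Finset (Fin n)}

open Finset

namespace Code

/-- The counter of the rounds. -/
abbrev roundCtr : ℕ := 38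

/-- Deletes rows until their number is bounded or the instance turns out to be a no-instance. -/
def compress : Code :=
  setup ;; forN 0 roundCtr round

theorem run_compress (hd : d ≠ 0) (M : PartialMatrix n) :
    EncodesBordered (compress.run (input M d)) M d ∧
      ∃ A, Reduces (compress.run (input M d)) M d A ∧
        ((compress.run (input M d)).nat no 0 0 = 0 → M.Bounded d #A) := by
  have h := encodesBordered_setup M d
  refine ⟨h.frame (frame_run (forN 0 roundCtr round) _) (by decide), ?_⟩
  suffices ∃ A, Reduces (compress.run (input M d)) M d A ∧
      ((compress.run (input M d)).nat no 0 0 = 0 → M.Bounded d #A ∨ #A + (n + 0) ≤ n) by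
    obtain ⟨A, hA, hbound⟩ := this
    exact ⟨A, hA, fun hno => (hbound hno).elim id fun h t _ _ => by simp [show #A = 0 by omega]⟩
  refine forN_induction (fun i t => ∃ A, Reduces t M d A ∧
    (t.nat no 0 0 = 0 → M.Bounded d #A ∨ #A + i ≤ n)) h.encodes.1 ?_ ?_
  · refine ⟨univ, (reduces_setup M d).congr (State.nat_setNat_of_ne _ (by decide) ..)
      (State.nat_setNat_of_ne _ (by decide) ..), fun _ => .inr (by simp)⟩
  · rintro i t ht - ⟨A, hA, hbound⟩
    obtain ⟨B, hB, hBA, hround⟩ := run_round hd (h.frame ht (by decide)) hA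
    refine ⟨B, hB.congr (State.nat_setNat_of_ne _ (by decide) ..)
      (State.nat_setNat_of_ne _ (by decide) ..), fun hno => ?_⟩
    rw [State.nat_setNat_of_ne _ (by decide)] at hno
    obtain ⟨hno', hB | hlt⟩ := hround.resolve_left (not_not.2 hno)
    · exact .inl hB
    · refine (hbound (hno' ▸ hno)).imp (.mono hBA) fun h => ?_
      omega

/-- Announces the answer. -/
def answer : Code :=
  ite (.natLE (.const 1) (var no)) (letN 3 (.const 0))
    (ite (.natLE (var 0) (.const 0)) (letN 3 (.const 1)) (letN 3 (.const 2)))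

/-- The compression algorithm. -/
def main : Code :=
  compress ;; answer ;; compact

theorem wf_main : main.WF := by
  decide

theorem run_main (hd : d ≠ 0) (M : PartialMatrix n) :
    ((main.run (input M d)).verdict = 0 ∧ ¬ M.Completable d) ∨
      ((main.run (input M d)).verdict = 1 ∧ M.Completable d) ∨
      ((main.run (input M d)).verdict = 2 ∧ ∃ (m : ℕ) (f : Fin m ↪o Fin n), 1 ≤ m ∧
        Encodes (main.run (input M d)) (M.principal f) d ∧
        ((M.principal f).Completable d ↔ M.Completable d) ∧ M.Bounded d m) := by
  obtain ⟨h, A, hA, hbound⟩ := run_compress hd M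
  set s := compress.run (input M d)
  have hverdict : (main.run (input M d)).verdict = (answer.run s).nat 3 0 0 := by
    simp [main, State.verdict, run_nat (p := compact) (a := 3) (by decide), s]
  rw [hverdict, PartialMatrix.completable_iff]
  have hn : s.nat 0 0 0 = n := h.encodes.1
  by_cases hno : s.nat no 0 0 = 0
  · rcases eq_or_ne n 0 with rfl | hn0
    · exact .inr (.inl ⟨by simp [answer, hno, hn], 0, by simp⟩)
    · refine .inr (.inr ⟨by simp [answer, hno, hn, hn0], #A, A.orderEmbOfFin rfl,
        card_pos.2 (hA.nonempty hn0), ?_, ?_, hbound hno⟩)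
      · exact run_compact (h.frame (frame_run answer s) (by decide))
          (hA.alive.congr (run_nat (by decide)))
      · rw [PartialMatrix.completable_principal_iff, map_orderEmbOfFin_univ]
        exact ⟨hA.realizable, .mono (subset_univ A)⟩
  · exact .inl ⟨by simp [answer, Nat.one_le_iff_ne_zero, hno],
      fun hM => hA.no hno (hM.mono (subset_univ A))⟩

end Code

end RealRAM

theorem theorem1p2 :
    ∃ (P : RealRAM.Prog) (T : Polynomial ℕ) (C : ℕ),
      ∀ (n d : ℕ) (M : PartialMatrix n), 1 ≤ d →
        ∃ (s : RealRAM.State) (k : ℕ),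
          RealRAM.Exec P (RealRAM.input M d) s k ∧ k ≤ T.eval n ∧
          ((s.verdict = 0 ∧ ¬ M.Completable d) ∨
           (s.verdict = 1 ∧ M.Completable d) ∨
           (s.verdict = 2 ∧ ∃ (m : ℕ) (f : Fin m ↪o Fin n), 1 ≤ m ∧
              RealRAM.Encodes s (M.principal f) d ∧
              ((M.principal f).Completable d ↔ M.Completable d) ∧
              ∀ t : ℕ, 1 ≤ t → M.ExcludesBlock t → m ≤ (d + 1) ^ (C * t ^ 2))) := by
  refine ⟨RealRAM.Code.main.toProg, RealRAM.Code.main.time, 20, fun n d M hd => ?_⟩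
  obtain ⟨k, hk, hkT⟩ := RealRAM.Code.exec_run RealRAM.Code.wf_main (RealRAM.input M d)
  rw [(RealRAM.encodes_input M d).1] at hkT
  exact ⟨_, k, hk, hkT, RealRAM.Code.run_main (Nat.one_le_iff_ne_zero.1 hd) M⟩
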